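/- **Setting.** Let $V$ be a finite set and let $x^0$ be a feasible solution of the subtour elimination LP on $V$ (i.e. $x^0_e\ge 0$ for all pairs $e$, $x^0(\delta(v))=2$ for all $v\in V$, and $x^0(\delta(S))\ge 2$ for all $\emptyset\ne S\subsetneq V$) such that $x^0_{e_0}=1$ for some edge $e_0=\{u_0,v_0\}$, $u_0\neq v_0$. Let $E\cup\{e_0\}$ be the support of $x^0$ (with $e_0\notin E$), let $x$ be $x^0$ restricted to $E$, and $G=(V,E)$. For $S\subseteq V$ let $\delta(S)\subseteq E$ be the set of edges with exactly one endpoint in $S$; for disjoint $A,B\subseteq V$ let $E(A,B)$ be the set of edges between $A$ and $B$; write $y(F)=\sum_{e\in F}y_e$ and $F_T=|F\cap T|$. Let $\mathcal N_\eta$ be the family of nonempty $S\subseteq V\smallsetminus\{u_0,v_0\}$ with $x(\delta(S))<2+\eta$. Two sets $A,B$ cross if $A\cap B$, $A\smallsetminus B$, $B\smallsetminus A$, $V\smallsetminus(A\cup B)$ are all nonempty. A connected component of a family of cuts is a connected component of the graph on the family whose edges are the crossing pairs; its atoms are the parts of the coarsest partition of $V$ each part of which is, for every cut $S$ of the component,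 contained in $S$ or in $V\smallsetminus S$. A polygon representation of a component $\mathcal C$ is a regular $m$-gon together with a diagonal for every cut of $\mathcal C$ and an assignment of the atoms of $\mathcal C$ to the cells into which the diagonals divide the polygon, such that the two sides of each cut are the unions of the atoms on the two sides of its diagonal, no cell contains more than one side of the polygon, and every cell that contains a side of the polygon contains an atom. These atoms are the outside atoms $a_0,\dots,a_{m-1}$, labelled counterclockwise. The other atoms are the inside atoms; they are exactly the atoms $a$ for which there is a $k$-cycle avoiding $a$, i.e. $k\ge 3$ and sets $C_1,\dots,C_k$, each a side of a cut of $\mathcal C$ and disjoint from $a$, such that (cyclically) $C_i$ crosses $C_{i+1}$, $C_i\cap C_j=\emptyset$ for $j\notin\{i-1,i,i+1\}$, $\bigcup_i C_i\neq V$, and, if $k=3$, $C_i\cap C_{i+1}\not\subseteq C_{i-1}$ for all $i$. "Left" means clockwise and "right" means counterclockwise. If $S'$ crosses $S$, it does so on the left if the leftmost outside atom of $S\cup S'$ is in $S'$, and on the right otherwise. A cut is crossed on one side if it is crossed by cuts of its component only on the left or only on the right. Let $\mathcal N_{\eta,1}$ be the set of cuts in $\mathcal N_\eta$ that are crossed on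 one side in a polygon representation of their component of $\mathcal N_\eta$. Let $\mathcal C$ be a connected component of $\mathcal N_{\eta,1}$ with $|\mathcal C|\ge 2$, and let $P$ be a polygon representation of $\mathcal C$, labelled such that $a_0$ is the root, i.e. the atom containing $u_0,v_0$. The relevant cuts are $\mathcal C_+=\mathcal C\cup\{a_i: 1\le i\le m-1,\ x(\delta(a_i))\le 2+\eta\}$. A leftmost (rightmost) cut is a cut in $\mathcal C$ with leftmost atom $a_1$ (rightmost atom $a_{m-1}$); $a_1$ is the leftmost and $a_{m-1}$ the rightmost atom. Put $A=E(a_1,a_0)$, $B=E(a_{m-1},a_0)$, $C=\delta(a_0)\smallsetminus A\smallsetminus B$. For a spanning tree $T$ of $G$, $P$ is left-happy if $A_T$ is odd and $C_T=0$, and right-happy if $B_T$ is odd and $C_T=0$. **Theorem.** Let $\mu$ be any distribution of spanning trees of $G$ with marginals $x$, i.e. $\Pr_{T\sim\mu}[e\in T]=x_e$ for all $e\in E$. Let $\alpha>0$, $0<\eta\le 1/10$ and $\epsilon_\eta=7\eta$. There is a random vector $s^*:E\to\mathbb R_{\ge 0}$, a function of $T\sim\mu$, such that: 1. For every connected component $\mathcal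 C$ of $\mathcal N_{\eta,1}$ with $|\mathcal C|\ge 2$, every polygon representation $P$ of $\mathcal C$ as above, every spanning tree $T$ of $G$ and every $S\in\mathcal C_+$ with $\delta(S)_T$ odd: - if $S$ is not a leftmost or rightmost cut or atom, then $s^*(\delta(S))\ge\alpha(1-\epsilon_\eta)$; - if $P$ is left-happy and $S$ is a leftmost cut or the leftmost atom, then $s^*(\delta(S))\ge\alpha(1-\epsilon_\eta)$; - if $P$ is right-happy and $S$ is a rightmost cut or the rightmost atom, then $s^*(\delta(S))\ge\alpha(1-\epsilon_\eta)$. 2. $\mathbb E_{T\sim\mu}[s^*_e]\le 44\,\alpha\,\eta\,x_e$ for all $e\in E$. -/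

import Mathlib

namespace NearMinCut

variable {V : Type*} [Fintype V] [DecidableEq V]

/-! ### Edge sets and the subtour elimination LP -/

open scoped Classical in
/-- `E(A, B)`: the edges of `E` with one endpoint in `A` and the other one in `B`. -/
noncomputable def edgesBetween (E : Finset (Sym2 V)) (A B : Finset V) : Finset (Sym2 V) :=
  E.filter (fun e => ∃ u ∈ A, ∃ v ∈ B, e = s(u, v))

/-- `δ(S)`: the edges of `E` with exactly one endpoint in `S`. -/
noncomputable def delta (E : Finset (Sym2 V)) (S : Finset V) : Finset (Sym2 V) :=
  edgesBetween E S Sᶜ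

/-- `x` is a feasible solution of the subtour elimination LP on the complete graph on `V`. The
values of `x` on loops are irrelevant and never used. -/
structure IsSubtourSolution (x : Sym2 V → ℝ) : Prop where
  nonneg : ∀ e : Sym2 V, ¬ e.IsDiag → 0 ≤ x e
  degree : ∀ v : V, ∑ e ∈ delta Finset.univ {v}, x e = 2
  cut : ∀ S : Finset V, S.Nonempty → S ≠ Finset.univ → 2 ≤ ∑ e ∈ delta Finset.univ S, x e

open scoped Classical in
/-- The edge set `E` of `G`: the support of `x` without the edge `e₀ = {u₀, v₀}`. -/
noncomputable def supportEdges (x : Sym2 V → ℝ) (u₀ v₀ : V) : Finset (Sym2 V) :=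
  Finset.univ.filter (fun e => ¬ e.IsDiag ∧ e ≠ s(u₀, v₀) ∧ 0 < x e)

/-! ### Spanning trees and distributions of spanning trees -/

/-- `T` is (the edge set of) a spanning tree of the graph with vertex set `V` and edge set `E`. -/
def IsSpanningTree (E T : Finset (Sym2 V)) : Prop :=
  T ⊆ E ∧ (SimpleGraph.fromEdgeSet (T : Set (Sym2 V))).IsTree

/-- `μ` is (the mass function of) a probability distribution on the spanning trees of `(V, E)`
whose marginals are `x`. -/
structure IsTreeDistribution (E : Finset (Sym2 V)) (x : Sym2 V → ℝ)
    (μ : Finset (Sym2 V) → ℝ) : Prop where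
  nonneg : ∀ T, 0 ≤ μ T
  support : ∀ T, μ T ≠ 0 → IsSpanningTree E T
  total : ∑ T, μ T = 1
  marginal : ∀ e ∈ E, (∑ T, if e ∈ T then μ T else 0) = x e

/-! ### Near minimum cuts, crossing, connected components, atoms -/

/-- `𝒩_η`: the `η`-near minimum cuts, each one given by its side that avoids `u₀` and `v₀`. -/
def nearMinCuts (E : Finset (Sym2 V)) (x : Sym2 V → ℝ) (u₀ v₀ : V) (η : ℝ) : Set (Finset V) :=
  {S | S.Nonempty ∧ u₀ ∉ S ∧ v₀ ∉ S ∧ ∑ e ∈ delta E S, x e < 2 + η}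

/-- `A` and `B` cross. -/
def Crosses (A B : Finset V) : Prop :=
  (A ∩ B).Nonempty ∧ (A \ B).Nonempty ∧ (B \ A).Nonempty ∧ ((A ∪ B)ᶜ).Nonempty

/-- `C` is a connected component of the graph on the family `F` whose edges are the crossing
pairs. -/
def IsComponent (F C : Set (Finset V)) : Prop :=
  ∃ S ∈ F, C = {S' | Relation.ReflTransGen (fun A B => A ∈ F ∧ B ∈ F ∧ Crosses A B) S S'}

open scoped Classical in
/-- The atom of the family `C` that contains the vertex `v`: all vertices that are on the same
side as `v` of every cut in `C`. -/
noncomputable def atomOf (C : Set (Finset V)) (v : V) : Finset V :=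
  Finset.univ.filter (fun w => ∀ S ∈ C, v ∈ S ↔ w ∈ S)

/-- The atoms of `C` are the parts of the coarsest partition of `V` such that each part is
contained in `S` or in its complement, for every `S ∈ C`. -/
def IsAtom (C : Set (Finset V)) (a : Finset V) : Prop :=
  ∃ v, a = atomOf C v

/-- A cyclic sequence of `k ≥ 3` sets forming a `k`-cycle. -/
structure IsCycle (k : ℕ) (c : ZMod k → Finset V) : Prop where
  three_le : 3 ≤ k
  crosses : ∀ i, Crosses (c i) (c (i + 1))
  disjoint : ∀ i j, j ≠ i - 1 → j ≠ i → j ≠ i + 1 → Disjoint (c i) (c j)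
  union_ne : ∃ v, ∀ i, v ∉ c i
  three : k = 3 → ∀ i, ¬ c i ∩ c (i + 1) ⊆ c (i - 1)

/-- Some `k`-cycle, each set of which is a side of a cut in `C`, avoids the set `a`. -/
def AvoidedByCycle (C : Set (Finset V)) (a : Finset V) : Prop :=
  ∃ (k : ℕ) (c : ZMod k → Finset V), IsCycle k c ∧
    (∀ i, c i ∈ C ∨ (c i)ᶜ ∈ C) ∧ ∀ i, Disjoint a (c i)

/-! ### Polygon representations -/

/-- The vertices `p_0, …, p_{m-1}` of a regular `m`-gon in the plane, counterclockwise. -/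
noncomputable def polygonPoint (m : ℕ) (k : ZMod m) : ℂ :=
  Complex.exp (2 * Real.pi * Complex.I * (k.val : ℂ) / (m : ℂ))

/-- Positive if `z` is strictly to the left of the directed line from `a` to `b`, negative if it
is strictly to the right. -/
noncomputable def orient (a b z : ℂ) : ℝ :=
  ((starRingEnd ℂ) (b - a) * (z - a)).im

/-- A polygon representation of a family `C` of cuts: a regular polygon with vertices
`p_0, …, p_{m-1}`, a diagonal for each cut of `C`, and the atoms of `C` in the cells into which
the diagonals divide the polygon. -/
structure PolygonRep (C : Set (Finset V)) where
  /-- the number of sides -/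
  m : ℕ
  three_le : 3 ≤ m
  /-- The cut `S ∈ C` is represented by the diagonal from `p_(diagFst S)` to `p_(diagSnd S)`,
  directed so that `S` is to the right of it. -/
  diagFst : Finset V → ZMod m
  diagSnd : Finset V → ZMod m
  diag_ne : ∀ S ∈ C, diagFst S ≠ diagSnd S ∧ diagFst S + 1 ≠ diagSnd S ∧
    diagSnd S + 1 ≠ diagFst S
  /-- a point of the cell that contains the atom of the vertex `v` -/
  pos : V → ℂ
  pos_mem : ∀ v, pos v ∈ interior (convexHull ℝ (Set.range (polygonPoint m)))
  pos_right : ∀ S ∈ C, ∀ v ∈ S,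
    orient (polygonPoint m (diagFst S)) (polygonPoint m (diagSnd S)) (pos v) < 0
  pos_left : ∀ S ∈ C, ∀ v ∉ S,
    0 < orient (polygonPoint m (diagFst S)) (polygonPoint m (diagSnd S)) (pos v)
  /-- `outer k` is the outside atom `a_k`, whose cell contains the side from `p_k` to `p_(k+1)`. -/
  outer : ZMod m → Finset V
  outer_atom : ∀ k, IsAtom C (outer k)
  /-- No cell contains more than one side of the polygon. -/
  outer_injective : Function.Injective outer
  /-- With `i = diagFst S` and `j = diagSnd S`, the sides to the right of the diagonal of `S` are
  the sides number `i, i + 1, …, j - 1` (modulo `m`). -/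
  outer_subset_iff : ∀ S ∈ C, ∀ k,
    outer k ⊆ S ↔ (k - diagFst S).val < (diagSnd S - diagFst S).val
  /-- The inside atoms, i.e. those that are not outside atoms, are the atoms surrounded by a
  `k`-cycle of cuts of `C`. -/
  inside_iff : ∀ a, IsAtom C a → (a ∉ Set.range outer ↔ AvoidedByCycle C a)

namespace PolygonRep

variable {C : Set (Finset V)} (P : PolygonRep C)

/-- `a_i` is a leftmost (clockwise-most) outside atom of `X`. -/
def IsLeftmost (X : Finset V) (i : ZMod P.m) : Prop :=
  P.outer i ⊆ X ∧ ¬ P.outer (i - 1) ⊆ X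

/-- `a_i` is a rightmost (counterclockwise-most) outside atom of `X`. -/
def IsRightmost (X : Finset V) (i : ZMod P.m) : Prop :=
  P.outer i ⊆ X ∧ ¬ P.outer (i + 1) ⊆ X

/-- `S'` crosses `S` on the left: the leftmost outside atom of `S' ∪ S` is in `S'`. -/
def CrossesOnLeft (S' S : Finset V) : Prop :=
  Crosses S' S ∧ ∃ i, P.IsLeftmost (S' ∪ S) i ∧ P.outer i ⊆ S'

/-- `S'` crosses `S` on the right: it crosses `S`, but not on the left. -/
def CrossesOnRight (S' S : Finset V) : Prop :=
  Crosses S' S ∧ ¬ P.CrossesOnLeft S' S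

/-- `S` is crossed by cuts of `C` only on the left or only on the right. -/
def CrossedOnOneSide (S : Finset V) : Prop :=
  Xor (∃ S' ∈ C, P.CrossesOnLeft S' S) (∃ S' ∈ C, P.CrossesOnRight S' S)

/-! From here on the root is the atom `a_0`, so `a_1` is the leftmost and `a_{m-1} = a_{-1}` the
rightmost atom of the polygon. -/

/-- `S ∈ 𝒞₊`: `S` is a cut of `C`, or an atom `a_i`, `i ≠ 0`, with `x(δ(a_i)) ≤ 2 + η`. -/
def IsRelevant (E : Finset (Sym2 V)) (x : Sym2 V → ℝ) (η : ℝ) (S : Finset V) : Prop :=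
  S ∈ C ∨ ∃ i : ZMod P.m, i ≠ 0 ∧ S = P.outer i ∧ ∑ e ∈ delta E S, x e ≤ 2 + η

/-- `S` is a leftmost cut or the leftmost atom. -/
def IsLeftmostCutOrAtom (S : Finset V) : Prop :=
  (S ∈ C ∧ P.IsLeftmost S 1) ∨ S = P.outer 1

/-- `S` is a rightmost cut or the rightmost atom. -/
def IsRightmostCutOrAtom (S : Finset V) : Prop :=
  (S ∈ C ∧ P.IsRightmost S (-1)) ∨ S = P.outer (-1)

/-- The part `A = E(a_1, a_0)` of the polygon partition of `δ(a_0)`. -/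
noncomputable def partA (E : Finset (Sym2 V)) : Finset (Sym2 V) :=
  edgesBetween E (P.outer 1) (P.outer 0)

/-- The part `B = E(a_{m-1}, a_0)` of the polygon partition of `δ(a_0)`. -/
noncomputable def partB (E : Finset (Sym2 V)) : Finset (Sym2 V) :=
  edgesBetween E (P.outer (-1)) (P.outer 0)

/-- The part `C = δ(a_0) ∖ A ∖ B` of the polygon partition of `δ(a_0)`. -/
noncomputable def partC (E : Finset (Sym2 V)) : Finset (Sym2 V) :=
  (delta E (P.outer 0) \ P.partA E) \ P.partB E

/-- The polygon is left-happy for the tree `T`. -/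
def LeftHappy (E T : Finset (Sym2 V)) : Prop :=
  Odd (P.partA E ∩ T).card ∧ (P.partC E ∩ T).card = 0

/-- The polygon is right-happy for the tree `T`. -/
def RightHappy (E T : Finset (Sym2 V)) : Prop :=
  Odd (P.partB E ∩ T).card ∧ (P.partC E ∩ T).card = 0

end PolygonRep

/-- `𝒩_{η,1}`: the `η`-near minimum cuts that are crossed on one side in the polygon of their
connected component of `𝒩_η`. -/
def oneSidedCuts (E : Finset (Sym2 V)) (x : Sym2 V → ℝ) (u₀ v₀ : V) (η : ℝ) :
    Set (Finset V) :=
  {S | ∃ D, IsComponent (nearMinCuts E x u₀ v₀ η) D ∧ S ∈ D ∧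
    ∃ P : PolygonRep D, P.CrossedOnOneSide S}

end NearMinCut

/-! The vector raises an edge only on events of probability at most `11 η`, and every edge takes
part in at most four of them; this gives `44 α η x_e`. What remains is to see that, under the stated
conditions, a relevant cut is odd only within such a rare event, and that it then receives enough
weight.

Structure of a component. All cuts crossing a given S do so at the same end of S (`CrossedAlike`).
Uncrossing then produces more cells of weight at least 2 than the near minimum cuts can pay for,
which excludes every k-cycle (`IsOneSidedFamily.not_avoidedByCycle`). So the polygon of C has
outside atoms only, and its cuts are intervals of {1, …, m-1}, with the root at 0, none of them
overlapped from both sides (`PolygonRep.isIntervalModel`).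

Rare events. All degrees away from u₀, v₀ are 2, so a set M avoiding u₀, v₀ lacks on average
x(δ(M))/2 - 1 of the |M| - 1 edges a tree may have inside it
(`IsTreeDistribution.expect_deficiency`). Suppose two near minimum cuts leave S without meeting
outside of S. Then T typically has an edge of δ(S) inside each, while δ(S)_T has mean at most 2 + η;
hence δ(S)_T is rarely odd (`IsTreeDistribution.treeProb_odd_le`). The combinatorics of intervals
yields such arms for every relevant cut except some leftmost or rightmost ones
(`PolygonRep.IsRelevant.arms_or_boundary`). For these, with U the union of C, the sets S, U ∖ S and
U are all near minimum cuts, so the number of tree edges between S and U ∖ S is rarely even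
(`IsTreeDistribution.treeProb_even_le`). In a happy polygon the tree edges from S to the root are
those of A or of B, an odd number, so an odd δ(S)_T forces this rare even number.

Charging. C splits into two laminar families (`PolygonRep.exists_splits`), and the atoms fit into
either. Each member S charges the edges from S to the rest of the next larger member, or of U if
there is none; their weight is at least 1 - η (`exists_charged`). On the rare event of S they are
raised by α x_e. An edge determines the component (`IsComponent.eq_of_separates`), and the family
together with the endpoint inside S then determines S (`card_charges_le`). -/

set_option linter.unusedSectionVars false

namespace NearMinCut

variable {V : Type*} [Fintype V] [DecidableEq V]

/-! ### Weights between vertex sets -/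

/-- The total weight of the ordered pairs in `A × B`. -/
def pairWeight (g : Sym2 V → ℝ) (A B : Finset V) : ℝ := ∑ u ∈ A, ∑ v ∈ B, g s(u, v)

/-- The weight of the cut `(S, Sᶜ)`. -/
def cutWeight (g : Sym2 V → ℝ) (S : Finset V) : ℝ := pairWeight g S Sᶜ

theorem pairWeight_eq_sum_ite (g : Sym2 V → ℝ) (A B : Finset V) :
    pairWeight g A B = ∑ u, ∑ v, if u ∈ A ∧ v ∈ B then g s(u, v) else 0 := by
  rw [pairWeight, ← Finset.sum_subset (Finset.subset_univ A)
    fun u _ hu => Finset.sum_eq_zero fun v _ => by simp [hu]]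
  refine Finset.sum_congr rfl fun u hu => ?_
  rw [← Finset.sum_subset (Finset.subset_univ B) fun v _ hv => by simp [hv]]
  exact Finset.sum_congr rfl fun v hv => by simp [hu, hv]

theorem cutWeight_eq_sum_ite (g : Sym2 V → ℝ) (S : Finset V) :
    cutWeight g S = ∑ u, ∑ v, if u ∈ S ∧ v ∉ S then g s(u, v) else 0 := by
  simp [cutWeight, pairWeight_eq_sum_ite]

theorem pairWeight_comm (g : Sym2 V → ℝ) (A B : Finset V) :
    pairWeight g A B = pairWeight g B A := by
  rw [pairWeight, pairWeight, Finset.sum_comm]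
  simp only [Sym2.eq_swap]

theorem pairWeight_nonneg {g : Sym2 V → ℝ} (hg : ∀ e, 0 ≤ g e) (A B : Finset V) :
    0 ≤ pairWeight g A B :=
  Finset.sum_nonneg fun _ _ => Finset.sum_nonneg fun _ _ => hg _

theorem pairWeight_mono_right {g : Sym2 V → ℝ} (hg : ∀ e, 0 ≤ g e) (A : Finset V)
    {B B' : Finset V} (h : B ⊆ B') : pairWeight g A B ≤ pairWeight g A B' :=
  Finset.sum_le_sum fun _ _ => Finset.sum_le_sum_of_subset_of_nonneg h fun _ _ _ => hg _

theorem pairWeight_mono_left {g : Sym2 V → ℝ} (hg : ∀ e, 0 ≤ g e) {A A' : Finset V}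
    (B : Finset V) (h : A ⊆ A') : pairWeight g A B ≤ pairWeight g A' B := by
  rw [pairWeight_comm, pairWeight_comm g A']
  exact pairWeight_mono_right hg B h

theorem pairWeight_union_right (g : Sym2 V → ℝ) (A : Finset V) {B B' : Finset V}
    (h : Disjoint B B') : pairWeight g A (B ∪ B') = pairWeight g A B + pairWeight g A B' := by
  simp only [pairWeight, Finset.sum_union h, Finset.sum_add_distrib]

theorem pairWeight_union_left (g : Sym2 V → ℝ) {A A' : Finset V} (B : Finset V)
    (h : Disjoint A A') : pairWeight g (A ∪ A') B = pairWeight g A B + pairWeight g A' B :=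
  Finset.sum_union h

theorem cutWeight_compl (g : Sym2 V → ℝ) (S : Finset V) : cutWeight g Sᶜ = cutWeight g S := by
  rw [cutWeight, cutWeight, compl_compl, pairWeight_comm]

theorem cutWeight_union (g : Sym2 V → ℝ) {X Y : Finset V} (h : Disjoint X Y) :
    cutWeight g (X ∪ Y) + 2 * pairWeight g X Y = cutWeight g X + cutWeight g Y := by
  rw [two_mul]
  nth_rewrite 2 [pairWeight_comm]
  simp only [pairWeight_eq_sum_ite, cutWeight_eq_sum_ite, ← Finset.sum_add_distrib]
  refine Finset.sum_congr rfl fun u _ => Finset.sum_congr rfl fun v _ => ?_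
  have h1 : u ∈ X → u ∉ Y := fun a => Finset.disjoint_left.1 h a
  have h2 : v ∈ X → v ∉ Y := fun a => Finset.disjoint_left.1 h a
  by_cases a : u ∈ X <;> by_cases b : u ∈ Y <;> by_cases c : v ∈ X <;> by_cases d : v ∈ Y <;>
    simp_all

theorem cutWeight_inter_add_cutWeight_union (g : Sym2 V → ℝ) (A B : Finset V) :
    cutWeight g (A ∩ B) + cutWeight g (A ∪ B) + 2 * pairWeight g (A \ B) (B \ A) =
      cutWeight g A + cutWeight g B := by
  rw [two_mul]
  nth_rewrite 2 [pairWeight_comm]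
  simp only [pairWeight_eq_sum_ite, cutWeight_eq_sum_ite, ← Finset.sum_add_distrib]
  refine Finset.sum_congr rfl fun u _ => Finset.sum_congr rfl fun v _ => ?_
  by_cases a : u ∈ A <;> by_cases b : u ∈ B <;> by_cases c : v ∈ A <;> by_cases d : v ∈ B <;>
    simp [a, b, c, d]

theorem cutWeight_inter_add_cutWeight_union_le {g : Sym2 V → ℝ} (hg : ∀ e, 0 ≤ g e)
    (A B : Finset V) :
    cutWeight g (A ∩ B) + cutWeight g (A ∪ B) ≤ cutWeight g A + cutWeight g B := by
  have h1 := cutWeight_inter_add_cutWeight_union g A B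
  have h2 := pairWeight_nonneg hg (A \ B) (B \ A)
  linarith

theorem cutWeight_sdiff_add_cutWeight_sdiff_le {g : Sym2 V → ℝ} (hg : ∀ e, 0 ≤ g e)
    (A B : Finset V) :
    cutWeight g (A \ B) + cutWeight g (B \ A) ≤ cutWeight g A + cutWeight g B := by
  have h := cutWeight_inter_add_cutWeight_union_le hg A Bᶜ
  rw [← Finset.sdiff_eq_inter_compl, cutWeight_compl, ← cutWeight_compl g (A ∪ Bᶜ),
    Finset.compl_union, compl_compl, Finset.inter_comm, ← Finset.sdiff_eq_inter_compl] at h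
  exact h

/-- The cuts of the eight cells of three sets weigh at most twice as much as the three sets. -/
theorem sum_cutWeight_cells_le {g : Sym2 V → ℝ} (hg : ∀ e, 0 ≤ g e) (A B S : Finset V) :
    cutWeight g ((A ∩ B) ∩ S) + cutWeight g ((A ∩ B) \ S) + cutWeight g ((A \ B) ∩ S) +
      cutWeight g ((A \ B) \ S) + cutWeight g ((B \ A) ∩ S) + cutWeight g ((B \ A) \ S) +
      cutWeight g (S \ (A ∪ B)) + cutWeight g ((A ∪ B) ∪ S) ≤
    2 * (cutWeight g A + cutWeight g B + cutWeight g S) := by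
  -- S splits each of the four cells of A and B. The edges cut in this way are disjoint parts of
  -- δ(S), so they add at most twice the weight of S.
  have key : ∀ X : Finset V, cutWeight g (X ∩ S) + cutWeight g (X \ S) =
      cutWeight g X + 2 * pairWeight g (X ∩ S) (X \ S) := by
    intro X
    have h := cutWeight_union g (X := X ∩ S) (Y := X \ S)
      (Finset.disjoint_left.2 fun v h1 h2 => by simp_all)
    rw [Finset.union_comm, Finset.sdiff_union_inter] at h
    linarith
  have e1 := key (A ∩ B)
  have e2 := key (A \ B)
  have e3 := key (B \ A)
  have e4 := key (A ∪ B)ᶜ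
  have h1 := cutWeight_inter_add_cutWeight_union_le hg A B
  have h2 := cutWeight_sdiff_add_cutWeight_sdiff_le hg A B
  have e5 : (A ∪ B)ᶜ ∩ S = S \ (A ∪ B) := by
    rw [Finset.inter_comm, Finset.sdiff_eq_inter_compl]
  have e6 : (A ∪ B)ᶜ \ S = (A ∪ B ∪ S)ᶜ := by
    rw [Finset.compl_union (A ∪ B), Finset.sdiff_eq_inter_compl]
  rw [cutWeight_compl, e6, cutWeight_compl, e5] at e4
  have h3 : pairWeight g ((A ∩ B) ∩ S) ((A ∩ B) \ S) + pairWeight g ((A \ B) ∩ S) ((A \ B) \ S) +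
      pairWeight g ((B \ A) ∩ S) ((B \ A) \ S) + pairWeight g (S \ (A ∪ B)) (A ∪ B ∪ S)ᶜ ≤
      cutWeight g S := by
    simp only [pairWeight_eq_sum_ite, cutWeight_eq_sum_ite, ← Finset.sum_add_distrib]
    refine Finset.sum_le_sum fun u _ => Finset.sum_le_sum fun v _ => ?_
    have := hg s(u, v)
    by_cases a : u ∈ A <;> by_cases b : u ∈ B <;> by_cases c : v ∈ A <;> by_cases d : v ∈ B <;>
      by_cases e : u ∈ S <;> by_cases f : v ∈ S <;> simp [a, b, c, d, e, f, this]
  linarith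

/-! ### Edge sums as weights -/

open scoped Classical in
/-- `g` on the edges of `F`, and `0` elsewhere. -/
noncomputable def restrictTo (F : Finset (Sym2 V)) (g : Sym2 V → ℝ) (e : Sym2 V) : ℝ :=
  if e ∈ F then g e else 0

theorem mem_edgesBetween {E : Finset (Sym2 V)} {A B : Finset V} {e : Sym2 V} :
    e ∈ edgesBetween E A B ↔ e ∈ E ∧ ∃ u ∈ A, ∃ v ∈ B, e = s(u, v) := by
  simp [edgesBetween]

theorem sum_edgesBetween (E : Finset (Sym2 V)) (g : Sym2 V → ℝ) {A B : Finset V}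
    (h : Disjoint A B) :
    ∑ e ∈ edgesBetween E A B, g e = pairWeight (restrictTo E g) A B := by
  classical
  rw [pairWeight, ← Finset.sum_product']
  simp only [restrictTo]
  rw [← Finset.sum_filter]
  symm
  refine Finset.sum_bij (fun p _ => s(p.1, p.2)) ?_ ?_ ?_ ?_
  · intro p hp
    simp only [Finset.mem_filter, Finset.mem_product] at hp
    exact mem_edgesBetween.2 ⟨hp.2, p.1, hp.1.1, p.2, hp.1.2, rfl⟩
  · intro p hp q hq hpq
    simp only [Finset.mem_filter, Finset.mem_product] at hp hq
    rcases Sym2.eq_iff.1 hpq with ⟨h1, h2⟩ | ⟨h1, h2⟩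
    · exact Prod.ext h1 h2
    · exact absurd (h1 ▸ hp.1.1) (fun h3 => Finset.disjoint_left.1 h h3 hq.1.2)
  · intro e he
    obtain ⟨he, u, hu, v, hv, rfl⟩ := mem_edgesBetween.1 he
    exact ⟨(u, v), by simp [hu, hv, he], rfl⟩
  · intros
    rfl

theorem sum_delta (E : Finset (Sym2 V)) (g : Sym2 V → ℝ) (S : Finset V) :
    ∑ e ∈ delta E S, g e = cutWeight (restrictTo E g) S :=
  sum_edgesBetween E g disjoint_compl_right

theorem card_edgesBetween_inter {E T : Finset (Sym2 V)} (hT : T ⊆ E) {A B : Finset V}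
    (h : Disjoint A B) :
    ((edgesBetween E A B ∩ T).card : ℝ) = pairWeight (restrictTo T fun _ => 1) A B := by
  rw [← sum_edgesBetween T _ h, Finset.sum_const, nsmul_one]
  congr 2
  ext e
  simp only [Finset.mem_inter, mem_edgesBetween]
  exact ⟨fun h => ⟨h.2, h.1.2⟩, fun h => ⟨⟨hT h.1, h.2⟩, h.1⟩⟩

theorem card_delta_inter {E T : Finset (Sym2 V)} (hT : T ⊆ E) (S : Finset V) :
    ((delta E S ∩ T).card : ℝ) = cutWeight (restrictTo T fun _ => 1) S :=
  card_edgesBetween_inter hT disjoint_compl_right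

/-! ### Trees inside a vertex set -/

/-- The weight inside `X`, in terms of the degrees and the weight of the cut of `X`. -/
theorem pairWeight_self (g : Sym2 V → ℝ) (X : Finset V) :
    pairWeight g X X = ∑ u ∈ X, ∑ v, g s(u, v) - cutWeight g X := by
  rw [cutWeight, eq_sub_iff_add_eq, ← pairWeight_union_right _ _ disjoint_compl_right,
    Finset.union_compl, pairWeight]

theorem pairWeight_union_self (g : Sym2 V → ℝ) {X Y : Finset V} (h : Disjoint X Y) :
    pairWeight g (X ∪ Y) (X ∪ Y) =
      pairWeight g X X + pairWeight g Y Y + 2 * pairWeight g X Y := by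
  rw [pairWeight_union_left g _ h, pairWeight_union_right g _ h, pairWeight_union_right g _ h,
    pairWeight_comm g Y X]
  ring

/-- A forest extends to a spanning tree of the complete graph. -/
theorem card_edgeFinset_add_one_le_of_isAcyclic {W : Type*} [Fintype W] [Nonempty W]
    (G : SimpleGraph W) [Fintype G.edgeSet] (hG : G.IsAcyclic) :
    G.edgeFinset.card + 1 ≤ Fintype.card W := by
  classical
  obtain ⟨F, hF, -, hT⟩ :=
    SimpleGraph.connected_top.exists_isTree_le_of_le_of_isAcyclic le_top hG
  rw [← hT.card_edgeFinset]
  exact Nat.succ_le_succ (Finset.card_le_card (SimpleGraph.edgeFinset_mono hF))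

/-- A forest has at most `|X| - 1` edges inside a nonempty vertex set `X`. -/
theorem pairWeight_self_le_of_isAcyclic {T : Finset (Sym2 V)} (hloop : ∀ e ∈ T, ¬ e.IsDiag)
    (hT : (SimpleGraph.fromEdgeSet (T : Set (Sym2 V))).IsAcyclic) {X : Finset V}
    (hX : X.Nonempty) :
    pairWeight (restrictTo T fun _ => 1) X X ≤ 2 * ((X.card : ℝ) - 1) := by
  classical
  have : Nonempty X := hX.to_subtype
  set G := (SimpleGraph.fromEdgeSet (T : Set (Sym2 V))).induce (X : Set V) with hG
  have h1 := card_edgeFinset_add_one_le_of_isAcyclic G (hT.induce _)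
  have h2 := G.sum_degrees_eq_twice_card_edges
  -- Ordered pairs count each edge twice, as the degree sum does; hence the factor 2 in the bound.
  have h3 : pairWeight (restrictTo T fun _ => 1) X X = ((∑ v, G.degree v : ℕ) : ℝ) := by
    rw [pairWeight, ← Finset.sum_coe_sort]
    push_cast
    refine Finset.sum_congr rfl fun u _ => ?_
    rw [← Finset.sum_coe_sort, ← SimpleGraph.card_neighborFinset_eq_degree, ← nsmul_one,
      ← Finset.sum_const, SimpleGraph.neighborFinset_eq_filter, Finset.sum_filter]
    refine Finset.sum_congr rfl fun v _ => ?_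
    have : G.Adj u v ↔ s((u : V), (v : V)) ∈ T := by
      simp only [hG, SimpleGraph.comap_adj, SimpleGraph.fromEdgeSet_adj,
        Function.Embedding.subtype_apply, Finset.mem_coe, and_iff_left_iff_imp]
      intro h h'
      exact hloop _ h (by simpa using h')
    simp only [restrictTo, this]
  rw [h3, h2]
  have h4 : Fintype.card (X : Set V) = X.card := by simp
  rw [h4] at h1
  have h5 : (G.edgeFinset.card : ℝ) + 1 ≤ X.card := by exact_mod_cast h1
  push_cast
  linarith

/-! ### Chords of a regular polygon -/

/-- Two open circular segments cut off by chords over disjoint arcs do not meet. The arcs have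
midpoints `a`, `b` and half-lengths `h`, `k`. -/
theorem not_mem_two_circular_segments {h k a b X Y : ℝ} (hh : 0 < h) (hk : 0 < k)
    (h1 : h + k ≤ b - a) (h2 : b - a ≤ 2 * Real.pi - (h + k)) (hXY : X ^ 2 + Y ^ 2 ≤ 1)
    (h3 : Real.cos h < X * Real.cos a + Y * Real.sin a)
    (h4 : Real.cos k < X * Real.cos b + Y * Real.sin b) : False := by
  have hsh : 0 < Real.sin h := Real.sin_pos_of_pos_of_lt_pi hh (by linarith)
  have hsk : 0 < Real.sin k := Real.sin_pos_of_pos_of_lt_pi hk (by linarith)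
  have hs : 0 ≤ Real.sin (h + k) := Real.sin_nonneg_of_nonneg_of_le_pi (by linarith) (by linarith)
  have hcos : Real.cos (b - a) ≤ Real.cos (h + k) := by
    rcases le_total (b - a) Real.pi with hπ | hπ
    · exact Real.cos_le_cos_of_nonneg_of_le_pi (by linarith) hπ h1
    · rw [← Real.cos_two_pi_sub (b - a)]
      exact Real.cos_le_cos_of_nonneg_of_le_pi (by linarith) (by linarith) (by linarith)
  -- Weighting the chord inequalities by `sin k` and `sin h` gives `X c + Y d > sin (h + k)`. By
  -- Cauchy–Schwarz in the unit disc the left side is at most the norm of `(c, d)`, which is at most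
  -- `sin (h + k)`.
  set c := Real.cos a * Real.sin k + Real.cos b * Real.sin h with hc
  set d := Real.sin a * Real.sin k + Real.sin b * Real.sin h with hd
  have hlt : Real.sin (h + k) < X * c + Y * d := by
    rw [Real.sin_add]
    have e1 := mul_lt_mul_of_pos_right h3 hsk
    have e2 := mul_lt_mul_of_pos_right h4 hsh
    rw [hc, hd]
    linarith
  have hcd : c ^ 2 + d ^ 2 =
      Real.sin k ^ 2 + Real.sin h ^ 2 + 2 * Real.sin h * Real.sin k * Real.cos (b - a) := by
    rw [Real.cos_sub, hc, hd]
    have e1 := Real.sin_sq_add_cos_sq a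
    have e2 := Real.sin_sq_add_cos_sq b
    linear_combination (Real.sin k ^ 2) * e1 + (Real.sin h ^ 2) * e2
  have hsq : Real.sin (h + k) ^ 2 =
      Real.sin k ^ 2 + Real.sin h ^ 2 + 2 * Real.sin h * Real.sin k * Real.cos (h + k) := by
    rw [Real.sin_add, Real.cos_add]
    have e1 := Real.sin_sq_add_cos_sq h
    have e2 := Real.sin_sq_add_cos_sq k
    linear_combination (Real.sin k ^ 2) * e1 + (Real.sin h ^ 2) * e2
  have hle : c ^ 2 + d ^ 2 ≤ Real.sin (h + k) ^ 2 := by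
    rw [hcd, hsq]
    have := mul_le_mul_of_nonneg_left hcos (mul_pos hsh hsk).le
    linarith
  have hcs : (X * c + Y * d) ^ 2 ≤ (X ^ 2 + Y ^ 2) * (c ^ 2 + d ^ 2) := by
    nlinarith [sq_nonneg (X * d - Y * c)]
  have hcs' : (X ^ 2 + Y ^ 2) * (c ^ 2 + d ^ 2) ≤ 1 * (c ^ 2 + d ^ 2) :=
    mul_le_mul_of_nonneg_right hXY (by positivity)
  have := pow_lt_pow_left₀ hlt hs two_ne_zero
  linarith

/-- The chord with midpoint direction `a` and half-angle `h` has distance `cos h` from the centre,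
so the side of `z` is decided by its projection to that direction. -/
theorem orient_circle (a h : ℝ) (z : ℂ) :
    orient (Complex.exp (((a - h : ℝ) : ℂ) * Complex.I)) (Complex.exp (((a + h : ℝ) : ℂ) * Complex.I))
      z = 2 * Real.sin h * (Real.cos h - (z.re * Real.cos a + z.im * Real.sin a)) := by
  have e1 := Real.sin_sq_add_cos_sq a
  have e2 := Real.sin_sq_add_cos_sq h
  simp only [orient, Complex.mul_im, Complex.conj_re, Complex.conj_im, Complex.sub_re,
    Complex.sub_im, Complex.exp_ofReal_mul_I_re, Complex.exp_ofReal_mul_I_im, Real.cos_add,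
    Real.sin_add, Real.cos_sub, Real.sin_sub]
  linear_combination (2 * Real.sin h * Real.cos h) * e1

theorem orient_swap (a b z : ℂ) : orient b a z = -orient a b z := by
  simp [orient, Complex.mul_im]
  ring

theorem polygonPoint_natCast (m : ℕ) [NeZero m] (n : ℕ) :
    polygonPoint m (n : ZMod m) =
      Complex.exp (((2 * Real.pi * n / m : ℝ) : ℂ) * Complex.I) := by
  have hm : (m : ℂ) ≠ 0 := Nat.cast_ne_zero.2 (NeZero.ne m)
  rw [polygonPoint, ZMod.val_natCast, Complex.exp_eq_exp_iff_exists_int]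
  refine ⟨-((n / m : ℕ) : ℤ), ?_⟩
  have h : ((n % m : ℕ) : ℂ) + m * ((n / m : ℕ) : ℂ) = n := by
    exact_mod_cast Nat.mod_add_div n m
  rw [Int.cast_neg, Int.cast_natCast]
  generalize ((n / m : ℕ) : ℂ) = q at h ⊢
  push_cast
  rw [← h]
  field_simp
  ring

theorem polygonPoint_norm (m : ℕ) [NeZero m] (k : ZMod m) : ‖polygonPoint m k‖ = 1 := by
  rw [← ZMod.natCast_zmod_val k, polygonPoint_natCast, Complex.norm_exp_ofReal_mul_I]

theorem norm_le_one_of_mem_polygon {m : ℕ} [NeZero m] {z : ℂ}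
    (hz : z ∈ interior (convexHull ℝ (Set.range (polygonPoint m)))) : ‖z‖ ≤ 1 := by
  have h : convexHull ℝ (Set.range (polygonPoint m)) ⊆ Metric.closedBall 0 1 := by
    refine convexHull_min ?_ (convex_closedBall _ _)
    rintro _ ⟨k, rfl⟩
    simp [polygonPoint_norm]
  simpa using h (interior_subset hz)

/-- If the segments to the right of two diagonals meet, then the diagonals cut off a common side
of the polygon. -/
theorem exists_mem_both_arcs {m : ℕ} [NeZero m] {i j i' j' : ZMod m} (hij : i ≠ j)
    (hij' : i' ≠ j') {z : ℂ} (hz : ‖z‖ ≤ 1)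
    (h : orient (polygonPoint m i) (polygonPoint m j) z < 0)
    (h' : orient (polygonPoint m i') (polygonPoint m j') z < 0) :
    ∃ k : ZMod m, (k - i).val < (j - i).val ∧ (k - i').val < (j' - i').val := by
  by_contra! hdis
  have hn : 0 < (j - i).val := by
    rw [Nat.pos_iff_ne_zero, Ne, ZMod.val_eq_zero, sub_eq_zero]
    exact hij.symm
  have hn' : 0 < (j' - i').val := by
    rw [Nat.pos_iff_ne_zero, Ne, ZMod.val_eq_zero, sub_eq_zero]
    exact hij'.symm
  -- Neither arc contains the starting point of the other, so the cyclic order is i, j, i', j', and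
  -- the lengths satisfy n ≤ r and r + n' ≤ m.
  have h1 : (j' - i').val ≤ (i - i').val := hdis i (by simpa using hn)
  have h2 : (j - i).val ≤ (i' - i).val := by
    by_contra! hlt
    have := hdis i' hlt
    rw [sub_self, ZMod.val_zero] at this
    omega
  have hne : i' - i ≠ 0 := by
    intro h0
    rw [h0, ZMod.val_zero] at h2
    omega
  have h3 : (i - i').val = m - (i' - i).val := by
    rw [← neg_sub, ZMod.neg_val, if_neg hne]
  have h4 := ZMod.val_lt (i' - i)
  set p := i.val
  set n := (j - i).val with hn_def
  set r := (i' - i).val with hr_def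
  set n' := (j' - i').val with hn'_def
  have hi : i = ((p : ℕ) : ZMod m) := by simp [p]
  have hj : j = ((p + n : ℕ) : ZMod m) := by simp [p, n]
  have hi' : i' = ((p + r : ℕ) : ZMod m) := by simp [p, r]
  have hj' : j' = ((p + r + n' : ℕ) : ZMod m) := by simp [p, r, n']
  have hm : (0 : ℝ) < m := Nat.cast_pos.2 (NeZero.pos m)
  -- The arc from vertex s to vertex s + d has its midpoint at angle π(2s + d)/m and half-length
  -- πd/m.
  have key : ∀ s d : ℕ, 0 < d → d < m →
      orient (polygonPoint m (s : ZMod m)) (polygonPoint m ((s + d : ℕ) : ZMod m)) z < 0 →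
      Real.cos (Real.pi * d / m) < z.re * Real.cos (Real.pi * (2 * s + d) / m) +
        z.im * Real.sin (Real.pi * (2 * s + d) / m) := by
    intro s d hd hdm ho
    have e1 : (2 * Real.pi * s / m : ℝ) = Real.pi * (2 * s + d) / m - Real.pi * d / m := by ring
    have e2 : (2 * Real.pi * (s + d : ℕ) / m : ℝ) =
        Real.pi * (2 * s + d) / m + Real.pi * d / m := by push_cast; ring
    rw [polygonPoint_natCast, polygonPoint_natCast, e1, e2, orient_circle] at ho
    have hd' : (0 : ℝ) < d := Nat.cast_pos.2 hd
    have hs : 0 < Real.sin (Real.pi * d / m) := by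
      refine Real.sin_pos_of_pos_of_lt_pi (by have := Real.pi_pos; positivity) ?_
      rw [div_lt_iff₀ hm]
      exact mul_lt_mul_of_pos_left (Nat.cast_lt.2 hdm) Real.pi_pos
    nlinarith
  rw [hi, hj] at h
  rw [hi', hj'] at h'
  have hc := key p n hn (ZMod.val_lt _) h
  have hc' := key (p + r) n' hn' (ZMod.val_lt _) h'
  have hπ := Real.pi_pos
  have hpn : (0 : ℝ) < n := Nat.cast_pos.2 hn
  have hpn' : (0 : ℝ) < n' := Nat.cast_pos.2 hn'
  have hnr : (n : ℝ) ≤ r := Nat.cast_le.2 h2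
  have hrn : (r : ℝ) + n' ≤ m := by
    have : r + n' ≤ m := by omega
    exact_mod_cast this
  refine not_mem_two_circular_segments (by positivity) (by positivity) ?_ ?_ ?_ hc hc'
  · push_cast
    rw [← sub_nonneg]
    have : Real.pi * (2 * (p + r) + n') / m - Real.pi * (2 * p + n) / m -
      (Real.pi * n / m + Real.pi * n' / m) = Real.pi * (2 * (r - n)) / m := by ring
    rw [this]
    have : (0 : ℝ) ≤ r - n := by linarith
    positivity
  · push_cast
    rw [← sub_nonneg]
    have : 2 * Real.pi - (Real.pi * n / m + Real.pi * n' / m) -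
        (Real.pi * (2 * (p + r) + n') / m - Real.pi * (2 * p + n) / m) =
        Real.pi * (2 * (m - (r + n'))) / m := by field_simp; ring
    rw [this]
    have : (0 : ℝ) ≤ m - (r + n') := by linarith
    positivity
  · have := Complex.sq_norm z
    rw [Complex.normSq_apply] at this
    nlinarith [norm_nonneg z]

/-! ### Atoms -/

theorem mem_atomOf {C : Set (Finset V)} {v w : V} :
    w ∈ atomOf C v ↔ ∀ S ∈ C, v ∈ S ↔ w ∈ S := by
  simp [atomOf]

theorem self_mem_atomOf (C : Set (Finset V)) (v : V) : v ∈ atomOf C v :=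
  mem_atomOf.2 fun _ _ => Iff.rfl

theorem IsAtom.eq_atomOf {C : Set (Finset V)} {a : Finset V} (ha : IsAtom C a) {v : V}
    (hv : v ∈ a) : a = atomOf C v := by
  obtain ⟨w, rfl⟩ := ha
  ext z
  simp only [mem_atomOf] at hv ⊢
  exact forall₂_congr fun S hS => by rw [hv S hS]

theorem IsAtom.eq_of_mem {C : Set (Finset V)} {a b : Finset V} (ha : IsAtom C a)
    (hb : IsAtom C b) {v : V} (hva : v ∈ a) (hvb : v ∈ b) : a = b :=
  (ha.eq_atomOf hva).trans (hb.eq_atomOf hvb).symm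

theorem IsAtom.nonempty {C : Set (Finset V)} {a : Finset V} (ha : IsAtom C a) : a.Nonempty := by
  obtain ⟨w, rfl⟩ := ha
  exact ⟨w, self_mem_atomOf C w⟩

theorem IsAtom.subset_of_mem {C : Set (Finset V)} {a S : Finset V} (ha : IsAtom C a)
    (hS : S ∈ C) {v : V} (hva : v ∈ a) (hvS : v ∈ S) : a ⊆ S := by
  rw [ha.eq_atomOf hva]
  exact fun w hw => (mem_atomOf.1 hw S hS).1 hvS

/-! ### Arcs of a polygon representation -/

/-- Turns cyclic positions into linear arithmetic on naturals, which `omega` can decide. -/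
theorem zmod_val_sub {m : ℕ} [NeZero m] (a b : ZMod m) :
    (b.val ≤ a.val ∧ (a - b).val + b.val = a.val) ∨
      (a.val < b.val ∧ (a - b).val + b.val = m + a.val) := by
  have ha := ZMod.val_lt a
  have hb := ZMod.val_lt b
  rcases le_or_gt b.val a.val with h | h
  · exact Or.inl ⟨h, by rw [ZMod.val_sub h]; omega⟩
  · refine Or.inr ⟨h, ?_⟩
    have h1 : (b - a).val = b.val - a.val := ZMod.val_sub h.le
    have h2 : b - a ≠ 0 := by
      intro h3
      rw [h3, ZMod.val_zero] at h1
      omega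
    rw [← neg_sub, ZMod.neg_val, if_neg h2, h1]
    omega

theorem zmod_val_sub_sub {m : ℕ} [NeZero m] (k l i : ZMod m) :
    ((l - i).val ≤ (k - i).val ∧ (k - l).val + (l - i).val = (k - i).val) ∨
      ((k - i).val < (l - i).val ∧ (k - l).val + (l - i).val = m + (k - i).val) := by
  simpa using zmod_val_sub (k - i) (l - i)

theorem Crosses.symm {A B : Finset V} (h : Crosses A B) : Crosses B A := by
  obtain ⟨h1, h2, h3, h4⟩ := h
  exact ⟨by rwa [Finset.inter_comm], h3, h2, by rwa [Finset.union_comm]⟩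

namespace PolygonRep

variable {C : Set (Finset V)} (P : PolygonRep C)

instance : NeZero P.m := ⟨by have := P.three_le; omega⟩

theorem one_val : (1 : ZMod P.m).val = 1 := by
  have : Fact (1 < P.m) := ⟨by have := P.three_le; omega⟩
  exact ZMod.val_one P.m

theorem outer_subset_of_mem {S : Finset V} (hS : S ∈ C) {k : ZMod P.m} {v : V}
    (hv : v ∈ P.outer k) (hvS : v ∈ S) : P.outer k ⊆ S :=
  (P.outer_atom k).subset_of_mem hS hv hvS

theorem outer_subset_union {A B : Finset V} (hA : A ∈ C) (hB : B ∈ C) (k : ZMod P.m) :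
    P.outer k ⊆ A ∪ B ↔ P.outer k ⊆ A ∨ P.outer k ⊆ B := by
  refine ⟨fun h => ?_, fun h => h.elim (fun h => h.trans Finset.subset_union_left)
    fun h => h.trans Finset.subset_union_right⟩
  obtain ⟨v, hv⟩ := (P.outer_atom k).nonempty
  exact (Finset.mem_union.1 (h hv)).imp (P.outer_subset_of_mem hA hv) (P.outer_subset_of_mem hB hv)

theorem not_outer_subset_iff_swap {S : Finset V} (hS : S ∈ C) (k : ZMod P.m) :
    ¬ P.outer k ⊆ S ↔
      (k - P.diagSnd S).val < (P.diagFst S - P.diagSnd S).val := by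
  rw [P.outer_subset_iff S hS]
  have h1 := zmod_val_sub_sub k (P.diagSnd S) (P.diagFst S)
  have h2 := zmod_val_sub_sub (P.diagFst S) (P.diagSnd S) (P.diagFst S)
  have h3 := ZMod.val_lt (k - P.diagFst S)
  have h4 := ZMod.val_lt (P.diagSnd S - P.diagFst S)
  have h5 := ZMod.val_lt (k - P.diagSnd S)
  have h6 := ZMod.val_lt (P.diagFst S - P.diagSnd S)
  rw [sub_self, ZMod.val_zero] at h2
  have h7 : (P.diagSnd S - P.diagFst S).val ≠ 0 := by
    rw [Ne, ZMod.val_eq_zero, sub_eq_zero]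
    exact (P.diag_ne S hS).1.symm
  omega

/-- A common vertex may belong to an inside atom, but its position lies in the segments of both
diagonals, so the two arcs share a side. -/
theorem exists_outer_inter {A B : Finset V} (hA : A ∈ C) (hB : B ∈ C) (h : (A ∩ B).Nonempty) :
    ∃ k, P.outer k ⊆ A ∧ P.outer k ⊆ B := by
  obtain ⟨v, hv⟩ := h
  obtain ⟨hvA, hvB⟩ := Finset.mem_inter.1 hv
  obtain ⟨k, h1, h2⟩ := exists_mem_both_arcs (P.diag_ne A hA).1 (P.diag_ne B hB).1
    (norm_le_one_of_mem_polygon (P.pos_mem v)) (P.pos_right A hA v hvA) (P.pos_right B hB v hvB)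
  exact ⟨k, (P.outer_subset_iff A hA k).2 h1, (P.outer_subset_iff B hB k).2 h2⟩

theorem exists_outer_sdiff {A B : Finset V} (hA : A ∈ C) (hB : B ∈ C) (h : (A \ B).Nonempty) :
    ∃ k, P.outer k ⊆ A ∧ ¬ P.outer k ⊆ B := by
  obtain ⟨v, hv⟩ := h
  obtain ⟨hvA, hvB⟩ := Finset.mem_sdiff.1 hv
  obtain ⟨k, h1, h2⟩ := exists_mem_both_arcs (P.diag_ne A hA).1 (P.diag_ne B hB).1.symm
    (norm_le_one_of_mem_polygon (P.pos_mem v)) (P.pos_right A hA v hvA)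
    (by rw [orient_swap]; exact neg_neg_of_pos (P.pos_left B hB v hvB))
  exact ⟨k, (P.outer_subset_iff A hA k).2 h1, (P.not_outer_subset_iff_swap hB k).2 h2⟩

theorem exists_outer_compl {A B : Finset V} (hA : A ∈ C) (hB : B ∈ C)
    (h : ((A ∪ B)ᶜ).Nonempty) : ∃ k, ¬ P.outer k ⊆ A ∧ ¬ P.outer k ⊆ B := by
  obtain ⟨v, hv⟩ := h
  simp only [Finset.mem_compl, Finset.mem_union, not_or] at hv
  obtain ⟨k, h1, h2⟩ := exists_mem_both_arcs (P.diag_ne A hA).1.symm (P.diag_ne B hB).1.symm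
    (norm_le_one_of_mem_polygon (P.pos_mem v))
    (by rw [orient_swap]; exact neg_neg_of_pos (P.pos_left A hA v hv.1))
    (by rw [orient_swap]; exact neg_neg_of_pos (P.pos_left B hB v hv.2))
  exact ⟨k, (P.not_outer_subset_iff_swap hA k).2 h1, (P.not_outer_subset_iff_swap hB k).2 h2⟩

/-- Membership of outside atoms in `A`, in the coordinate system with origin `i`. -/
theorem outer_subset_iff_coord {A : Finset V} (hA : A ∈ C) (i k : ZMod P.m) :
    P.outer k ⊆ A ↔
      ((P.diagFst A - i).val ≤ (k - i).val ∧
        (k - i).val < (P.diagFst A - i).val + (P.diagSnd A - P.diagFst A).val) ∨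
      ((k - i).val < (P.diagFst A - i).val ∧
        P.m + (k - i).val < (P.diagFst A - i).val + (P.diagSnd A - P.diagFst A).val) := by
  rw [P.outer_subset_iff A hA]
  have := zmod_val_sub_sub k (P.diagFst A) i
  omega

theorem val_pred (i l : ZMod P.m) :
    ((l - i).val = 0 ∧ (l - 1 - i).val = P.m - 1) ∨
      ((l - i).val ≠ 0 ∧ (l - 1 - i).val + 1 = (l - i).val) := by
  have h := zmod_val_sub (l - i) 1
  have h1 := ZMod.val_lt (l - i)
  rw [show l - i - 1 = l - 1 - i by ring, P.one_val] at h
  omega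

/-- A cut crossing `S` on the left contains the outside atoms on both sides of the left end of
`S`, but not the rightmost atom of `S`. -/
theorem CrossesOnLeft.corners {P : PolygonRep C} {A S : Finset V} (hA : A ∈ C) (hS : S ∈ C)
    (h : P.CrossesOnLeft A S) :
    (P.outer (P.diagFst S) ⊆ A ∧ P.outer (P.diagFst S) ⊆ S) ∧
    (P.outer (P.diagFst S - 1) ⊆ A ∧ ¬ P.outer (P.diagFst S - 1) ⊆ S) ∧
    (¬ P.outer (P.diagSnd S - 1) ⊆ A ∧ P.outer (P.diagSnd S - 1) ⊆ S) := by
  obtain ⟨⟨c1, c2, c3, c4⟩, l, ⟨hl1, hl2⟩, hl3⟩ := h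
  obtain ⟨k1, h1⟩ := P.exists_outer_inter hA hS c1
  obtain ⟨k2, h2⟩ := P.exists_outer_sdiff hA hS c2
  obtain ⟨k3, h3⟩ := P.exists_outer_sdiff hS hA c3
  obtain ⟨k4, h4⟩ := P.exists_outer_compl hA hS c4
  have hl2' : ¬ (P.outer (l - 1) ⊆ A ∨ P.outer (l - 1) ⊆ S) := fun h =>
    hl2 ((P.outer_subset_union hA hS _).2 h)
  -- Counted from its left end, S is {0, …, n-1}, and A is an arc such that all four quadrants
  -- contain outside atoms. As the union begins with an atom of A, the arc A contains m-1 and 0 and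
  -- misses n-1.
  have hb := P.val_pred (P.diagFst S) l
  have hb1 := P.val_pred (P.diagFst S) (P.diagFst S)
  have hb2 := P.val_pred (P.diagFst S) (P.diagSnd S)
  have b1 := ZMod.val_lt (k1 - P.diagFst S)
  have b2 := ZMod.val_lt (k2 - P.diagFst S)
  have b3 := ZMod.val_lt (k3 - P.diagFst S)
  have b4 := ZMod.val_lt (k4 - P.diagFst S)
  have b5 := ZMod.val_lt (l - P.diagFst S)
  have b6 := ZMod.val_lt (P.diagFst A - P.diagFst S)
  have b7 := ZMod.val_lt (P.diagSnd A - P.diagFst A)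
  have b8 := ZMod.val_lt (P.diagSnd S - P.diagFst S)
  rw [P.outer_subset_iff_coord hA (P.diagFst S)] at h1 h2 h3 h4 hl2' hl3 ⊢
  rw [P.outer_subset_iff_coord hA (P.diagFst S) (P.diagFst S - 1),
    P.outer_subset_iff_coord hA (P.diagFst S) (P.diagSnd S - 1)]
  rw [P.outer_subset_iff S hS] at h1 h2 h3 h4 hl2'
  rw [P.outer_subset_iff S hS, P.outer_subset_iff S hS, P.outer_subset_iff S hS]
  simp only [sub_self, ZMod.val_zero] at *
  omega

/-- A cut crossing `S` on the right contains the outside atoms on both sides of the right end of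
`S`, but not the leftmost atom of `S`. -/
theorem CrossesOnRight.corners {P : PolygonRep C} {A S : Finset V} (hA : A ∈ C) (hS : S ∈ C)
    (h : P.CrossesOnRight A S) :
    (P.outer (P.diagSnd S - 1) ⊆ A ∧ P.outer (P.diagSnd S - 1) ⊆ S) ∧
    (P.outer (P.diagSnd S) ⊆ A ∧ ¬ P.outer (P.diagSnd S) ⊆ S) ∧
    (¬ P.outer (P.diagFst S) ⊆ A ∧ P.outer (P.diagFst S) ⊆ S) := by
  obtain ⟨hc, hnl⟩ := h
  obtain ⟨c1, c2, c3, c4⟩ := id hc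
  obtain ⟨k1, h1⟩ := P.exists_outer_inter hA hS c1
  obtain ⟨k2, h2⟩ := P.exists_outer_sdiff hA hS c2
  obtain ⟨k3, h3⟩ := P.exists_outer_sdiff hS hA c3
  obtain ⟨k4, h4⟩ := P.exists_outer_compl hA hS c4
  -- Not crossing on the left means that the first atom of A does not begin the union: its
  -- predecessor is covered as well.
  have hl : P.outer (P.diagFst A) ⊆ A →
      (P.outer (P.diagFst A - 1) ⊆ A ∨ P.outer (P.diagFst A - 1) ⊆ S) := fun h1 =>
    by_contra fun h2 => hnl ⟨hc, P.diagFst A, ⟨h1.trans Finset.subset_union_left,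
      fun h3 => h2 ((P.outer_subset_union hA hS _).1 h3)⟩, h1⟩
  have hb := P.val_pred (P.diagFst S) (P.diagFst A)
  have hb2 := P.val_pred (P.diagFst S) (P.diagSnd S)
  have b1 := ZMod.val_lt (k1 - P.diagFst S)
  have b2 := ZMod.val_lt (k2 - P.diagFst S)
  have b3 := ZMod.val_lt (k3 - P.diagFst S)
  have b4 := ZMod.val_lt (k4 - P.diagFst S)
  have b6 := ZMod.val_lt (P.diagFst A - P.diagFst S)
  have b7 := ZMod.val_lt (P.diagSnd A - P.diagFst A)
  have b8 := ZMod.val_lt (P.diagSnd S - P.diagFst S)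
  have b9 : 0 < (P.diagSnd A - P.diagFst A).val := by
    rw [Nat.pos_iff_ne_zero, Ne, ZMod.val_eq_zero, sub_eq_zero]
    exact (P.diag_ne A hA).1.symm
  rw [P.outer_subset_iff_coord hA (P.diagFst S)] at h1 h2 h3 h4
  rw [P.outer_subset_iff_coord hA (P.diagFst S) (P.diagSnd S - 1),
    P.outer_subset_iff_coord hA (P.diagFst S) (P.diagSnd S),
    P.outer_subset_iff_coord hA (P.diagFst S) (P.diagFst S)]
  rw [P.outer_subset_iff_coord hA (P.diagFst S) (P.diagFst A),
    P.outer_subset_iff_coord hA (P.diagFst S) (P.diagFst A - 1)] at hl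
  rw [P.outer_subset_iff S hS] at h1 h2 h3 h4 hl
  rw [P.outer_subset_iff S hS, P.outer_subset_iff S hS, P.outer_subset_iff S hS]
  simp only [sub_self, ZMod.val_zero] at *
  omega

end PolygonRep

/-! ### Cuts crossed on one side -/

/-- Any two cuts of the family that cross `S` do so on the same side. -/
def CrossedAlike (C : Set (Finset V)) (S : Finset V) : Prop :=
  ∀ A ∈ C, ∀ B ∈ C, Crosses A S → Crosses B S →
    ((A ∩ B) ∩ S).Nonempty ∧ ((A ∩ B) \ S).Nonempty ∧ (S \ (A ∪ B)).Nonempty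

/-- The witnesses are the two outside atoms around the end of S where both cuts cross, and the atom
of S at its other end. The conclusion does not mention the polygon, so it carries over from a
component of 𝒩_η to a component of 𝒩_{η,1}, which has a polygon of its own. -/
theorem PolygonRep.CrossedOnOneSide.crossedAlike {C : Set (Finset V)} {P : PolygonRep C}
    {S : Finset V} (hS : S ∈ C) (h : P.CrossedOnOneSide S) : CrossedAlike C S := by
  intro A hA B hB hAS hBS
  have corner : ∀ k1 k2 k3 : ZMod P.m,
      (P.outer k1 ⊆ A ∧ P.outer k1 ⊆ S) ∧ (P.outer k2 ⊆ A ∧ ¬ P.outer k2 ⊆ S) ∧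
        (¬ P.outer k3 ⊆ A ∧ P.outer k3 ⊆ S) →
      (P.outer k1 ⊆ B ∧ P.outer k1 ⊆ S) ∧ (P.outer k2 ⊆ B ∧ ¬ P.outer k2 ⊆ S) ∧
        (¬ P.outer k3 ⊆ B ∧ P.outer k3 ⊆ S) →
      ((A ∩ B) ∩ S).Nonempty ∧ ((A ∩ B) \ S).Nonempty ∧ (S \ (A ∪ B)).Nonempty := by
    rintro k1 k2 k3 ⟨⟨a1, a2⟩, ⟨a3, a4⟩, a5, a6⟩ ⟨⟨b1, -⟩, ⟨b3, -⟩, b5, -⟩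
    obtain ⟨v1, h1⟩ := (P.outer_atom k1).nonempty
    obtain ⟨v2, h2⟩ := (P.outer_atom k2).nonempty
    obtain ⟨v3, h3⟩ := (P.outer_atom k3).nonempty
    refine ⟨⟨v1, by simp [a1 h1, b1 h1, a2 h1]⟩, ⟨v2, ?_⟩, ⟨v3, ?_⟩⟩
    · have : v2 ∉ S := fun h => a4 (P.outer_subset_of_mem hS h2 h)
      simp [a3 h2, b3 h2, this]
    · have h4 : v3 ∉ A := fun h => a5 (P.outer_subset_of_mem hA h3 h)
      have h5 : v3 ∉ B := fun h => b5 (P.outer_subset_of_mem hB h3 h)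
      simp [a6 h3, h4, h5]
  by_cases hAl : P.CrossesOnLeft A S <;> by_cases hBl : P.CrossesOnLeft B S
  · exact corner _ _ _ (hAl.corners hA hS) (hBl.corners hB hS)
  · rcases h with ⟨-, h⟩ | ⟨-, h⟩
    exacts [absurd ⟨B, hB, hBS, hBl⟩ h, absurd ⟨A, hA, hAl⟩ h]
  · rcases h with ⟨-, h⟩ | ⟨-, h⟩
    exacts [absurd ⟨A, hA, hAS, hAl⟩ h, absurd ⟨B, hB, hBl⟩ h]
  · exact corner _ _ _ (PolygonRep.CrossesOnRight.corners hA hS ⟨hAS, hAl⟩)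
      (PolygonRep.CrossesOnRight.corners hB hS ⟨hBS, hBl⟩)

/-! ### The cut function of a subtour solution -/

/-- The properties of the weights `x` on `E` that are inherited from the subtour solution: all
nonempty sets avoiding `u₀` and `v₀` have a cut of weight at least `2`, and all vertices other than
`u₀` and `v₀` have degree `2`. -/
structure IsCutSystem (g : Sym2 V → ℝ) (u₀ v₀ : V) : Prop where
  nonneg : ∀ e, 0 ≤ g e
  two_le : ∀ S : Finset V, S.Nonempty → u₀ ∉ S → v₀ ∉ S → 2 ≤ cutWeight g S
  degree : ∀ v, v ≠ u₀ → v ≠ v₀ → ∑ w, g s(v, w) = 2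

/-- A set avoiding both u₀ and v₀ does not cut e₀, so removing e₀ leaves its cut weight unchanged.
-/
theorem IsSubtourSolution.isCutSystem {x : Sym2 V → ℝ} (hx : IsSubtourSolution x) (u₀ v₀ : V) :
    IsCutSystem (restrictTo (supportEdges x u₀ v₀) x) u₀ v₀ := by
  have hmem : ∀ e, e ∈ supportEdges x u₀ v₀ ↔ ¬ e.IsDiag ∧ e ≠ s(u₀, v₀) ∧ 0 < x e := by
    simp [supportEdges]
  have hcut : ∀ S : Finset V, u₀ ∉ S → v₀ ∉ S →
      cutWeight (restrictTo (supportEdges x u₀ v₀) x) S = ∑ e ∈ delta Finset.univ S, x e := by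
    intro S hu hv
    rw [sum_delta]
    refine Finset.sum_congr rfl fun u huS => Finset.sum_congr rfl fun v hvS => ?_
    have hdiag : ¬ (s(u, v) : Sym2 V).IsDiag := by
      rw [Sym2.mk_isDiag_iff]
      rintro rfl
      exact Finset.mem_compl.1 hvS huS
    have hne : (s(u, v) : Sym2 V) ≠ s(u₀, v₀) := by
      intro h
      rcases Sym2.eq_iff.1 h with ⟨h, -⟩ | ⟨h, -⟩
      exacts [hu (h ▸ huS), hv (h ▸ huS)]
    have := hx.nonneg _ hdiag
    simp only [restrictTo, hmem, Finset.mem_univ, if_true]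
    split_ifs with h
    · rfl
    · have : ¬ 0 < x s(u, v) := fun h' => h ⟨hdiag, hne, h'⟩
      linarith
  refine ⟨fun e => ?_, fun S hS hu hv => ?_, fun v hu hv => ?_⟩
  · rw [restrictTo]
    split_ifs with h
    exacts [((hmem e).1 h).2.2.le, le_rfl]
  · rw [hcut S hu hv]
    exact hx.cut S hS fun h => hu (h ▸ Finset.mem_univ _)
  · rw [← hx.degree v, ← hcut {v} (by simpa using hu.symm) (by simpa using hv.symm), cutWeight,
      pairWeight, Finset.sum_singleton, ← Finset.sum_add_sum_compl {v} fun w => _,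
      Finset.sum_singleton]
    have : restrictTo (supportEdges x u₀ v₀) x s(v, v) = 0 := by
      simp [restrictTo, hmem]
    rw [this, zero_add]

/-! ### Families of cuts crossed on one side -/

theorem crosses_iff {A B : Finset V} :
    Crosses A B ↔ (∃ v, v ∈ A ∧ v ∈ B) ∧ (∃ v, v ∈ A ∧ v ∉ B) ∧ (∃ v, v ∈ B ∧ v ∉ A) ∧
      ∃ v, v ∉ A ∧ v ∉ B := by
  simp [Crosses, Finset.Nonempty]

theorem crosses_compl_left {A B : Finset V} : Crosses Aᶜ B ↔ Crosses A B := by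
  simp only [crosses_iff, Finset.mem_compl, not_not]
  constructor
  · rintro ⟨⟨a, h1⟩, ⟨b, h2⟩, ⟨c, h3⟩, ⟨d, h4⟩⟩
    exact ⟨⟨c, h3.symm⟩, ⟨d, h4⟩, ⟨a, h1.symm⟩, ⟨b, h2⟩⟩
  · rintro ⟨⟨a, h1⟩, ⟨b, h2⟩, ⟨c, h3⟩, ⟨d, h4⟩⟩
    exact ⟨⟨c, h3.symm⟩, ⟨d, h4⟩, ⟨a, h1.symm⟩, ⟨b, h2⟩⟩

theorem crosses_compl_right {A B : Finset V} : Crosses A Bᶜ ↔ Crosses A B :=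
  ⟨fun h => (crosses_compl_left.1 h.symm).symm, fun h => (crosses_compl_left.2 h.symm).symm⟩

/-- A connected family of at least two near minimum cuts avoiding `u₀` and `v₀` in which every cut
is crossed on one side only. -/
structure IsOneSidedFamily (g : Sym2 V → ℝ) (u₀ v₀ : V) (η : ℝ) (C : Set (Finset V)) : Prop where
  avoid : ∀ S ∈ C, u₀ ∉ S ∧ v₀ ∉ S
  near : ∀ S ∈ C, cutWeight g S < 2 + η
  alike : ∀ S ∈ C, CrossedAlike C S
  connected : ∀ Q : Finset V → Prop, (∀ A ∈ C, ∀ B ∈ C, Crosses A B → Q A → Q B) →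
    ∀ A ∈ C, ∀ B ∈ C, Q A → Q B
  nontrivial : C.Nontrivial

theorem IsComponent.subset {F C : Set (Finset V)} (hC : IsComponent F C) : C ⊆ F := by
  obtain ⟨S, hS, rfl⟩ := hC
  intro A hA
  rcases Relation.ReflTransGen.cases_tail hA with rfl | ⟨_, -, -, h, -⟩
  exacts [hS, h]

theorem IsComponent.mem_of_crosses {F C : Set (Finset V)} (hC : IsComponent F C)
    {A B : Finset V} (hA : A ∈ C) (hB : B ∈ F) (h : Crosses A B) : B ∈ C := by
  have hAF := hC.subset hA
  obtain ⟨S, hS, rfl⟩ := hC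
  exact Relation.ReflTransGen.tail hA ⟨hAF, hB, h⟩

theorem IsComponent.connected {F C : Set (Finset V)} (hC : IsComponent F C)
    (Q : Finset V → Prop) (hQ : ∀ A ∈ C, ∀ B ∈ C, Crosses A B → Q A → Q B) :
    ∀ A ∈ C, ∀ B ∈ C, Q A → Q B := by
  obtain ⟨S, hS, hCS⟩ := id hC
  have hSC : S ∈ C := hCS ▸ Relation.ReflTransGen.refl
  have key : ∀ A ∈ C, (Q S ↔ Q A) := by
    intro A hA
    rw [hCS] at hA
    change Relation.ReflTransGen _ S A at hA
    induction hA with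
    | refl => rfl
    | @tail A B hSA hAB ih =>
      have hA' : A ∈ C := hCS ▸ hSA
      have hB' := hC.mem_of_crosses hA' hAB.2.1 hAB.2.2
      exact ih.trans ⟨hQ A hA' B hB' hAB.2.2, hQ B hB' A hA' hAB.2.2.symm⟩
  exact fun A hA B hB h => (key B hB).1 ((key A hA).2 h)

theorem IsComponent.eq_of_mem {F C D : Set (Finset V)} (hC : IsComponent F C)
    (hD : IsComponent F D) {A : Finset V} (hAC : A ∈ C) (hAD : A ∈ D) : C = D := by
  refine Set.Subset.antisymm (fun B hB => ?_) fun B hB => ?_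
  · exact hC.connected (· ∈ D)
      (fun X _ Y hY h hX => hD.mem_of_crosses hX (hC.subset hY) h) A hAC B hB hAD
  · exact hD.connected (· ∈ C)
      (fun X _ Y hY h hX => hC.mem_of_crosses hX (hD.subset hY) h) A hAD B hB hAC

/-- A cut of C that crosses S is itself near minimum, hence lies in the component of S in 𝒩_η, in
whose polygon S is crossed on one side. -/
theorem IsComponent.isOneSidedFamily {E : Finset (Sym2 V)} {x : Sym2 V → ℝ} {u₀ v₀ : V} {η : ℝ}
    {C : Set (Finset V)} (hC : IsComponent (oneSidedCuts E x u₀ v₀ η) C) (hne : C.Nontrivial) :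
    IsOneSidedFamily (restrictTo E x) u₀ v₀ η C := by
  have hmin : ∀ S ∈ C, S ∈ nearMinCuts E x u₀ v₀ η := by
    intro S hS
    obtain ⟨D, hD, hSD, -⟩ := hC.subset hS
    exact hD.subset hSD
  refine ⟨fun S hS => ⟨(hmin S hS).2.1, (hmin S hS).2.2.1⟩, fun S hS => ?_, fun S hS => ?_,
    hC.connected, hne⟩
  · rw [← sum_delta]
    exact (hmin S hS).2.2.2
  · obtain ⟨D, hD, hSD, P, hP⟩ := hC.subset hS
    intro A hA B hB hAS hBS
    exact hP.crossedAlike hSD A (hD.mem_of_crosses hSD (hmin A hA) hAS.symm)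
      B (hD.mem_of_crosses hSD (hmin B hB) hBS.symm) hAS hBS

namespace IsOneSidedFamily

variable {g : Sym2 V → ℝ} {u₀ v₀ : V} {η : ℝ} {C : Set (Finset V)}

theorem exists_crosses (hC : IsOneSidedFamily g u₀ v₀ η C) {S : Finset V} (hS : S ∈ C) :
    ∃ B ∈ C, Crosses S B := by
  by_contra! h
  obtain ⟨B, hB, hne⟩ := hC.nontrivial.exists_ne S
  exact hne (hC.connected (· = S) (fun A _ B hB hAB hA => absurd (hA ▸ hAB) (h B hB)) S hS B hB rfl)

/-- By `CrossedAlike` all seven cells inside the union are nonempty. Together with the union they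
are eight cuts of weight at least 2, that is 16, but `sum_cutWeight_cells_le` allows less than 6(2 +
η). -/
theorem not_pairwise_crosses (hg : IsCutSystem g u₀ v₀) (hη : η ≤ 1 / 10)
    (hC : IsOneSidedFamily g u₀ v₀ η C) {A B S : Finset V} (hA : A ∈ C) (hB : B ∈ C) (hS : S ∈ C)
    (hAB : Crosses A B) (hBS : Crosses B S) (hAS : Crosses A S) : False := by
  obtain ⟨n1, n2, n3⟩ := hC.alike S hS A hA B hB hAS hBS
  obtain ⟨-, n4, n5⟩ := hC.alike A hA B hB S hS hAB.symm hAS.symm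
  obtain ⟨-, n6, n7⟩ := hC.alike B hB A hA S hS hAB hBS.symm
  have hle : ∀ X : Finset V, X ⊆ A ∪ B ∪ S → X.Nonempty → 2 ≤ cutWeight g X := by
    intro X hX hne
    refine hg.two_le X hne (fun h => ?_) fun h => ?_
    · have := hX h
      simp [(hC.avoid A hA).1, (hC.avoid B hB).1, (hC.avoid S hS).1] at this
    · have := hX h
      simp [(hC.avoid A hA).2, (hC.avoid B hB).2, (hC.avoid S hS).2] at this
  have h := sum_cutWeight_cells_le hg.nonneg A B S
  have h1 := hle (A ∩ B ∩ S) (by grind) n1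
  have h2 := hle ((A ∩ B) \ S) (by grind) n2
  have h3 := hle ((A \ B) ∩ S) (by grind) (n6.mono (by grind))
  have h4 := hle ((A \ B) \ S) (by grind) (n5.mono (by grind))
  have h5 := hle ((B \ A) ∩ S) (by grind) (n4.mono (by grind))
  have h6 := hle ((B \ A) \ S) (by grind) (n7.mono (by grind))
  have h7 := hle (S \ (A ∪ B)) (by grind) n3
  have h8 := hle (A ∪ B ∪ S) (by grind) (n1.mono (by grind))
  have := hC.near A hA
  have := hC.near B hB
  have := hC.near S hS
  linarith

/-- Two nested pairs of cuts with `P ⊆ A`, `Q ⊆ B` that form a `4`-cycle of crossing pairs leave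
no vertex of `A ∩ B` uncovered by `P ∪ Q`. -/
theorem inter_subset_union (hg : IsCutSystem g u₀ v₀) (hη : η ≤ 1 / 10)
    (hC : IsOneSidedFamily g u₀ v₀ η C) {A B P Q : Finset V} (hA : A ∈ C) (hB : B ∈ C)
    (hP : P ∈ C) (hQ : Q ∈ C) (hPA : P ⊆ A) (hQB : Q ⊆ B) (hPQ : Crosses P Q)
    (hQA : Crosses Q A) (hAB : Crosses A B) (hBP : Crosses B P) : A ∩ B ⊆ P ∪ Q := by
  by_contra hsub
  obtain ⟨v, hv, hv'⟩ := Finset.not_subset.1 hsub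
  have hle : ∀ X : Finset V, X ⊆ A ∪ B → X.Nonempty → 2 ≤ cutWeight g X := by
    intro X hX hne
    refine hg.two_le X hne (fun h => ?_) fun h => ?_
    · have := hX h
      simp [(hC.avoid A hA).1, (hC.avoid B hB).1] at this
    · have := hX h
      simp [(hC.avoid A hA).2, (hC.avoid B hB).2] at this
  have nA := hC.near A hA
  have nB := hC.near B hB
  have nP := hC.near P hP
  have nQ := hC.near Q hQ
  -- Adding the uncrossings leaves the cuts of A ∪ B, P ∩ Q, P ∖ B, Q ∖ A and of the uncovered part
  -- of A ∩ B: at least 10 against less than 8 + 4η. The edges lost by separating P ∖ B from Q ∖ A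
  -- are paid by those between A ∖ B and B ∖ A, which is why the uncrossing of A and B is kept
  -- exact.
  have h1 := cutWeight_inter_add_cutWeight_union g A B
  have h2 := cutWeight_inter_add_cutWeight_union_le hg.nonneg P Q
  have h3 := cutWeight_sdiff_add_cutWeight_sdiff_le hg.nonneg (A ∩ B) (P ∪ Q)
  have e : (P ∪ Q) \ (A ∩ B) = (P \ B) ∪ (Q \ A) := by grind
  have h4 := cutWeight_union g (X := P \ B) (Y := Q \ A)
    (Finset.disjoint_left.2 fun w h h' => by grind)
  have h5 : pairWeight g (P \ B) (Q \ A) ≤ pairWeight g (A \ B) (B \ A) :=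
    (pairWeight_mono_left hg.nonneg _ (by grind)).trans
      (pairWeight_mono_right hg.nonneg _ (by grind))
  have l1 := hle (A ∩ B) (by grind) hAB.1
  have l2 := hle (A ∪ B) (by grind) (hAB.1.mono (by grind))
  have l3 := hle (P ∩ Q) (by grind) hPQ.1
  have l4 := hle (P \ B) (by grind) hBP.2.2.1
  have l5 := hle (Q \ A) (by grind) hQA.2.1
  have l6 := hle ((A ∩ B) \ (P ∪ Q)) (by grind) ⟨v, by grind⟩
  rw [e] at h3
  linarith

/-- No atom of the family is avoided by a cycle. -/
theorem not_avoidedByCycle (hg : IsCutSystem g u₀ v₀) (hη : η ≤ 1 / 10)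
    (hC : IsOneSidedFamily g u₀ v₀ η C) (a : Finset V) : ¬ AvoidedByCycle C a := by
  rintro ⟨k, c, hc, hside, -⟩
  have hk := hc.three_le
  have : NeZero k := ⟨by omega⟩
  have hcast : ∀ n : ℕ, 0 < n → n < k → (n : ZMod k) ≠ 0 := by
    intro n h0 hn h
    have := Nat.le_of_dvd h0 ((ZMod.natCast_eq_zero_iff n k).1 h)
    omega
  have hmem : ∀ i, u₀ ∉ c i → c i ∈ C := by
    intro i hi
    refine (hside i).resolve_right fun h => ?_
    exact (hC.avoid _ h).1 (Finset.mem_compl.2 hi)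
  have hmem' : ∀ i, u₀ ∈ c i → (c i)ᶜ ∈ C := fun i hi =>
    (hside i).resolve_left fun h => (hC.avoid _ h).1 hi
  have hs : ∀ i, ∃ S ∈ C, S = c i ∨ S = (c i)ᶜ := fun i =>
    (hside i).elim (fun h => ⟨_, h, Or.inl rfl⟩) fun h => ⟨_, h, Or.inr rfl⟩
  have hcr : ∀ {A B A' B' : Finset V}, Crosses A B → (A' = A ∨ A' = Aᶜ) → (B' = B ∨ B' = Bᶜ) →
      Crosses A' B' := by
    rintro A B A' B' h (rfl | rfl) (rfl | rfl)
    exacts [h, crosses_compl_right.2 h, crosses_compl_left.2 h,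
      crosses_compl_left.2 (crosses_compl_right.2 h)]
  rcases hk.eq_or_lt with rfl | hk4
  · obtain ⟨S0, m0, e0⟩ := hs 0
    obtain ⟨S1, m1, e1⟩ := hs 1
    obtain ⟨S2, m2, e2⟩ := hs 2
    exact hC.not_pairwise_crosses hg hη m0 m1 m2 (hcr (hc.crosses 0) e0 e1)
      (hcr (hc.crosses 1) e1 e2) (hcr (hc.crosses 2) e2 e0).symm
  · have hdis : ∀ i, Disjoint (c (i - 1)) (c (i + 1)) := by
      intro i
      refine hc.disjoint _ _ (fun h => ?_) (fun h => ?_) fun h => ?_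
      · exact hcast 3 (by omega) (by omega) (by push_cast; linear_combination h)
      · exact hcast 2 (by omega) (by omega) (by push_cast; linear_combination h)
      · exact hcast 1 (by omega) (by omega) (by push_cast; linear_combination h)
    -- The sets c i and c (i + 2) are disjoint and both cross c (i + 1). If both avoided u₀, they
    -- would be members of C, and `CrossedAlike` would give them a common vertex.
    have halt : ∀ i, u₀ ∈ c (i + 2) ↔ u₀ ∉ c i := by
      intro i
      have hd := hdis (i + 1)
      have e : i + 1 + 1 = i + 2 := by ring
      rw [add_sub_cancel_right, e] at hd
      refine ⟨fun h h' => Finset.disjoint_left.1 hd h' h, fun h => by_contra fun h' => ?_⟩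
      obtain ⟨S, hS, eS⟩ := hs (i + 1)
      obtain ⟨⟨v, hv⟩, -, -⟩ := hC.alike S hS _ (hmem _ h) _ (hmem _ h')
        (hcr (hc.crosses i) (Or.inl rfl) eS)
        (hcr (hc.crosses (i + 1)) eS (Or.inl (by rw [e]))).symm
      simp only [Finset.mem_inter] at hv
      exact Finset.disjoint_left.1 hd hv.1.1 hv.1.2
    have halt4 : ∀ i, u₀ ∈ c (i + 4) ↔ u₀ ∈ c i := by
      intro i
      rw [show i + 4 = i + 2 + 2 by ring, halt, halt, not_not]
    have hnear : ∀ i j, u₀ ∈ c i → u₀ ∈ c j → j = i - 1 ∨ j = i ∨ j = i + 1 := by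
      intro i j hi hj
      by_contra! h
      exact Finset.disjoint_left.1 (hc.disjoint i j h.1 h.2.1 h.2.2) hi hj
    obtain ⟨i, hi⟩ : ∃ i, u₀ ∈ c i := by
      by_cases h : u₀ ∈ c 0
      · exact ⟨0, h⟩
      · exact ⟨0 + 2, (halt 0).2 h⟩
    rcases (Nat.succ_le_of_lt hk4).eq_or_lt with h4 | hk5
    · obtain rfl : k = 4 := h4.symm
      -- For k = 4 alternation leaves two consecutive sets avoiding u₀. They are contained in the
      -- complements of the opposite sets, which is the situation of `inter_subset_union`; a vertex
      -- outside the whole cycle contradicts it.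
      obtain ⟨j, hj, hj1⟩ : ∃ j, u₀ ∉ c j ∧ u₀ ∉ c (j + 1) := by
        have a0 := halt 0
        have a1 := halt 1
        have a2 := halt 2
        have a3 := halt 3
        rw [show (0 : ZMod 4) + 2 = 2 by decide] at a0
        rw [show (1 : ZMod 4) + 2 = 3 by decide] at a1
        rw [show (2 : ZMod 4) + 2 = 0 by decide] at a2
        rw [show (3 : ZMod 4) + 2 = 1 by decide] at a3
        by_cases t0 : u₀ ∈ c 0 <;> by_cases t1 : u₀ ∈ c 1
        · exact ⟨2, by tauto, by rw [show (2 : ZMod 4) + 1 = 3 by decide]; tauto⟩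
        · exact ⟨1, by tauto, by rw [show (1 : ZMod 4) + 1 = 2 by decide]; tauto⟩
        · exact ⟨3, by tauto, by rw [show (3 : ZMod 4) + 1 = 0 by decide]; tauto⟩
        · exact ⟨0, by tauto, by rw [show (0 : ZMod 4) + 1 = 1 by decide]; tauto⟩
      have hj2 := (halt j).2 hj
      have hj3 := (halt (j + 1)).2 hj1
      have d2 := hdis (j + 1)
      have d3 := hdis (j + 2)
      have x0 := hc.crosses j
      have x1 := hc.crosses (j + 1)
      have x2 := hc.crosses (j + 2)
      have x3 := hc.crosses (j + 3)
      rw [show j + 1 + 2 = j + 3 by ring] at hj3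
      rw [show j + 1 - 1 = j by ring, show j + 1 + 1 = j + 2 by ring] at d2
      rw [show j + 2 - 1 = j + 1 by ring, show j + 2 + 1 = j + 3 by ring] at d3
      rw [show j + 1 + 1 = j + 2 by ring] at x1
      rw [show j + 2 + 1 = j + 3 by ring] at x2
      rw [show j + 3 + 1 = j + 4 by ring, show (4 : ZMod 4) = 0 by decide, add_zero] at x3
      obtain ⟨v, hv⟩ := hc.union_ne
      have hv' := hC.inter_subset_union hg hη (hmem' _ hj2) (hmem' _ hj3) (hmem _ hj) (hmem _ hj1)
        (Finset.subset_compl_comm.1 (Finset.subset_compl_iff_disjoint_left.2 d2))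
        (Finset.subset_compl_comm.1 (Finset.subset_compl_iff_disjoint_left.2 d3))
        x0 (crosses_compl_right.2 x1) (crosses_compl_left.2 (crosses_compl_right.2 x2))
        (crosses_compl_left.2 x3) (show v ∈ _ by simp [hv])
      simp [hv] at hv'
    · rcases (Nat.succ_le_of_lt hk5).eq_or_lt with h5 | hk6
      -- Sets containing u₀ meet, so their indices are equal or adjacent. For k = 5 the index i + 8
      -- = i + 3 violates this, and for k ≥ 6 already i + 4 does.
      · rcases hnear i (i + 8) hi (by rw [show i + 8 = i + 4 + 4 by ring, halt4, halt4]; exact hi)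
          with h | h | h
        all_goals
          obtain rfl : k = 5 := h5.symm
          revert h
          clear hi
          revert i
          decide
      · rcases hnear i (i + 4) hi ((halt4 i).2 hi) with h | h | h
        · exact hcast 5 (by omega) (by omega) (by push_cast; linear_combination h)
        · exact hcast 4 (by omega) (by omega) (by push_cast; linear_combination h)
        · exact hcast 3 (by omega) (by omega) (by push_cast; linear_combination h)

end IsOneSidedFamily

/-! ### Systems of intervals crossed on one side -/

/-- `p` overlaps `q` from the left. -/
def Overlaps (p q : ℕ × ℕ) : Prop := p.1 < q.1 ∧ q.1 ≤ p.2 ∧ p.2 < q.2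

/-- A connected family of intervals in `{1, …, N}` each of which is crossed on one side only and
that separates the points `0, 1, …, N`. -/
structure IsIntervalSystem (N : ℕ) (I : Set (ℕ × ℕ)) : Prop where
  bounds : ∀ p ∈ I, 1 ≤ p.1 ∧ p.1 < p.2 ∧ p.2 ≤ N
  crossed : ∀ p ∈ I, ∃ q ∈ I, Overlaps p q ∨ Overlaps q p
  one_side : ∀ p ∈ I, ∀ q ∈ I, ∀ r ∈ I, Overlaps p q → ¬ Overlaps q r
  gap : ∀ a b, (∃ p ∈ I, a ≤ p.1 ∧ p.2 ≤ b) → (∃ p ∈ I, p.1 < a ∨ b < p.2) →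
    ∃ p ∈ I, (p.1 < a ∧ a ≤ p.2 ∧ p.2 < b) ∨ (a < p.1 ∧ p.1 ≤ b ∧ b < p.2)
  separated : ∀ i, 1 ≤ i → i < N → ∃ p ∈ I, p.2 = i ∨ p.1 = i + 1
  first : ∃ p ∈ I, p.1 = 1
  last : ∃ p ∈ I, p.2 = N

namespace IsIntervalSystem

variable {N : ℕ} {I : Set (ℕ × ℕ)}

/-- The mirror image of an interval in `{1, …, N}`. -/
def mirror (N : ℕ) (p : ℕ × ℕ) : ℕ × ℕ := (N + 1 - p.2, N + 1 - p.1)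

theorem reflect (h : IsIntervalSystem N I) : IsIntervalSystem N (mirror N '' I) := by
  have hb := h.bounds
  constructor
  · rintro _ ⟨p, hp, rfl⟩
    have := hb p hp
    simp only [mirror]
    omega
  · rintro _ ⟨p, hp, rfl⟩
    obtain ⟨q, hq, hpq⟩ := h.crossed p hp
    refine ⟨_, ⟨q, hq, rfl⟩, ?_⟩
    have := hb p hp
    have := hb q hq
    simp only [mirror, Overlaps] at *
    omega
  · rintro _ ⟨p, hp, rfl⟩ _ ⟨q, hq, rfl⟩ _ ⟨r, hr, rfl⟩ h1 h2
    have := hb p hp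
    have := hb q hq
    have := hb r hr
    refine h.one_side r hr q hq p hp ?_ ?_ <;> simp only [mirror, Overlaps] at * <;> omega
  · rintro a b ⟨_, ⟨p, hp, rfl⟩, h1⟩ ⟨_, ⟨q, hq, rfl⟩, h2⟩
    have := hb p hp
    have := hb q hq
    simp only [mirror] at h1 h2
    by_cases hc : b ≤ N ∧ 1 ≤ a
    · obtain ⟨r, hr, h3⟩ := h.gap (N + 1 - b) (N + 1 - a) ⟨p, hp, by omega⟩ ⟨q, hq, by omega⟩
      refine ⟨_, ⟨r, hr, rfl⟩, ?_⟩
      have := hb r hr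
      simp only [mirror]
      omega
    · rcases not_and_or.1 hc with hc | hc
      · obtain ⟨r, hr, h3⟩ := h.gap 1 (N + 1 - a) ⟨p, hp, by omega⟩ ⟨q, hq, by omega⟩
        refine ⟨_, ⟨r, hr, rfl⟩, ?_⟩
        have := hb r hr
        simp only [mirror]
        omega
      · obtain ⟨r, hr, h3⟩ := h.gap (N + 1 - b) N ⟨p, hp, by omega⟩ ⟨q, hq, by omega⟩
        refine ⟨_, ⟨r, hr, rfl⟩, ?_⟩
        have := hb r hr
        simp only [mirror]
        omega
  · intro i h1 h2
    obtain ⟨p, hp, h3⟩ := h.separated (N - i) (by omega) (by omega)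
    have := hb p hp
    refine ⟨_, ⟨p, hp, rfl⟩, ?_⟩
    simp only [mirror]
    omega
  · obtain ⟨p, hp, h1⟩ := h.last
    exact ⟨_, ⟨p, hp, rfl⟩, by simp only [mirror]; omega⟩
  · obtain ⟨p, hp, h1⟩ := h.first
    exact ⟨_, ⟨p, hp, rfl⟩, by simp only [mirror]; omega⟩

/-- Among the intervals with a given property there is one whose right end is maximal. -/
theorem exists_max_right (h : IsIntervalSystem N I) (Q : ℕ × ℕ → Prop) (hQ : ∃ p ∈ I, Q p) :
    ∃ p ∈ I, Q p ∧ ∀ q ∈ I, Q q → q.2 ≤ p.2 := by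
  have hfin : {p | p ∈ I ∧ Q p}.Finite :=
    Set.Finite.subset ((Set.finite_Iic N).prod (Set.finite_Iic N)) fun p hp => by
      have := h.bounds p hp.1
      simp only [Set.mem_prod, Set.mem_Iic]
      omega
  obtain ⟨p, hp, hmax⟩ := hfin.exists_maximalFor Prod.snd _ hQ
  exact ⟨p, hp.1, hp.2, fun q hq hQq => (le_total q.2 p.2).elim id fun h' => hmax ⟨hq, hQq⟩ h'⟩

/-- Two overlapping intervals cover `{1, …, N}`. -/
theorem exists_cover (h : IsIntervalSystem N I) :
    ∃ p ∈ I, ∃ q ∈ I, Overlaps p q ∧ p.1 = 1 ∧ q.2 = N := by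
  obtain ⟨A, hA, hA1⟩ := h.first
  have hcr : ∃ B ∈ I, Overlaps A B := by
    obtain ⟨B, hB, hAB | hBA⟩ := h.crossed A hA
    · exact ⟨B, hB, hAB⟩
    · have := h.bounds B hB
      simp only [Overlaps] at hBA
      omega
  obtain ⟨B, hB, hAB, hmax⟩ := h.exists_max_right _ hcr
  refine ⟨A, hA, B, hB, hAB, hA1, ?_⟩
  by_contra hne
  have hbB := h.bounds B hB
  obtain ⟨L, hL, hLN⟩ := h.last
  have hbA := h.bounds A hA
  simp only [Overlaps] at hAB hmax
  -- F leaves {1, …, B.2} to the right. It either overlaps A and reaches further than B, or overlaps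
  -- B, which A already overlaps from the left.
  obtain ⟨F, hF, hF'⟩ := h.gap 1 B.2 ⟨A, hA, by omega⟩ ⟨L, hL, by omega⟩
  have hbF := h.bounds F hF
  have h1 := h.one_side A hA B hB F hF
  have h2 := hmax F hF
  simp only [Overlaps] at h1
  omega

/-- If `S` is overlapped from the right, then `S` and another interval cover `{1, …, N}`, or the
overlap can be continued to the left. -/
theorem cover_or_extend (h : IsIntervalSystem N I) {S : ℕ × ℕ} (hS : S ∈ I)
    (hcr : ∃ B ∈ I, Overlaps S B) :
    (∃ B ∈ I, Overlaps S B ∧ S.1 = 1 ∧ B.2 = N) ∨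
      ∃ B ∈ I, ∃ F ∈ I, Overlaps S B ∧ Overlaps F B ∧ F.1 < S.1 ∧ S.2 ≤ F.2 := by
  obtain ⟨B, hB, hSB, hmax⟩ := h.exists_max_right _ hcr
  by_cases hc : S.1 = 1 ∧ B.2 = N
  · exact Or.inl ⟨B, hB, hSB, hc⟩
  right
  have hbS := h.bounds S hS
  have hbB := h.bounds B hB
  obtain ⟨p, hp, hp1⟩ := h.first
  obtain ⟨q, hq, hqN⟩ := h.last
  simp only [Overlaps] at hSB
  have hout : ∃ p ∈ I, p.1 < S.1 ∨ B.2 < p.2 := by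
    by_cases h1 : S.1 = 1
    · exact ⟨q, hq, by omega⟩
    · exact ⟨p, hp, by omega⟩
  -- By maximality of B and one-sidedness F enters from the left. It reaches S.2, as otherwise S
  -- would be overlapped from both sides.
  obtain ⟨F, hF, hF'⟩ := h.gap S.1 B.2 ⟨S, hS, by omega⟩ hout
  have hbF := h.bounds F hF
  have h1 := h.one_side F hF S hS B hB
  have h2 := h.one_side S hS B hB F hF
  have h3 := hmax F hF
  simp only [Overlaps] at h1 h2 h3 ⊢
  exact ⟨B, hB, F, hF, by omega⟩

/-- `{2, …, N}` is an interval of the system or the union of two overlapping ones. -/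
theorem exists_cover_two (h : IsIntervalSystem N I) (hN : 2 ≤ N) :
    (∃ S ∈ I, S.1 = 2 ∧ S.2 = N) ∨ ∃ S ∈ I, ∃ D ∈ I, Overlaps S D ∧ S.1 = 2 ∧ D.2 = N := by
  obtain ⟨p, hp, hp1⟩ := h.first
  obtain ⟨q, hq, hqN⟩ := h.last
  have hS0 : ∃ S ∈ I, S.1 = 2 := by
    obtain ⟨S, hS, h1⟩ := h.separated 1 le_rfl (by omega)
    have := h.bounds S hS
    exact ⟨S, hS, by omega⟩
  obtain ⟨S, hS, hS2, hSmax⟩ := h.exists_max_right _ hS0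
  have hbS := h.bounds S hS
  by_cases hSN : S.2 = N
  · exact Or.inl ⟨S, hS, hS2, hSN⟩
  right
  by_cases hcr : ∃ D ∈ I, Overlaps S D
  · obtain ⟨D, hD, hSD, hDmax⟩ := h.exists_max_right _ hcr
    refine ⟨S, hS, D, hD, hSD, hS2, ?_⟩
    by_contra hDN
    have hbD := h.bounds D hD
    simp only [Overlaps] at hSD
    obtain ⟨G, hG, hG'⟩ := h.gap 1 D.2 ⟨S, hS, by omega⟩ ⟨q, hq, by omega⟩
    have hbG := h.bounds G hG
    have b1 := h.one_side S hS D hD G hG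
    have b2 := hDmax G hG
    have b3 := hSmax G hG
    simp only [Overlaps] at b1 b2
    omega
  · obtain ⟨B, hB, hSB | hBS⟩ := h.crossed S hS
    · exact absurd ⟨B, hB, hSB⟩ hcr
    · exfalso
      have hbB := h.bounds B hB
      simp only [Overlaps] at hBS
      obtain ⟨F, hF, hF'⟩ := h.gap 1 S.2 ⟨S, hS, by omega⟩ ⟨q, hq, by omega⟩
      have hbF := h.bounds F hF
      have a1 := h.one_side B hB S hS F hF
      have a2 := hSmax F hF
      simp only [Overlaps] at a1
      omega

/-- The three ways in which an interval `{p, …, i}`, `p < i`, is obtained from the system. -/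
def HasLeftArm (I : Set (ℕ × ℕ)) (i : ℕ) : Prop :=
  (∃ Z ∈ I, Z.2 = i) ∨
    (∃ F ∈ I, ∃ W ∈ I, Overlaps F W ∧ W.1 = i + 1 ∧ F.1 < i) ∨
    ∃ F ∈ I, ∃ W ∈ I, ∃ D ∈ I, Overlaps W D ∧ W.1 = i + 1 ∧ F.1 < i ∧ i + 1 ≤ F.2 ∧ F.2 < D.2

/-- If no interval ends at i, then i and i + 1 are separated by one starting at i + 1. The longest
such W, or its union with the D reaching furthest right, is crossed from the left, and the crossing
interval minus it ends at i. Should the crossing interval start at i, `gap` is applied again with i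
as left end. -/
theorem hasLeftArm (h : IsIntervalSystem N I) {i : ℕ} (hi : 2 ≤ i) (hiN : i ≤ N) :
    HasLeftArm I i := by
  obtain ⟨p, hp, hp1⟩ := h.first
  by_cases hZ : ∃ Z ∈ I, Z.2 = i
  · exact Or.inl hZ
  right
  have hW0 : ∃ W ∈ I, W.1 = i + 1 := by
    by_cases hiN' : i = N
    · obtain ⟨q, hq, hqN⟩ := h.last
      exact absurd ⟨q, hq, by omega⟩ hZ
    · obtain ⟨W, hW, h1 | h1⟩ := h.separated i (by omega) (by omega)
      exacts [absurd ⟨W, hW, h1⟩ hZ, ⟨W, hW, h1⟩]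
  obtain ⟨W, hW, hWi, hWmax⟩ := h.exists_max_right _ hW0
  have hbW := h.bounds W hW
  by_cases hcr : ∃ D ∈ I, Overlaps W D
  · obtain ⟨D, hD, hWD, hDmax⟩ := h.exists_max_right _ hcr
    right
    have hbD := h.bounds D hD
    obtain ⟨e1, e2, e3⟩ := id hWD
    obtain ⟨F, hF, hF'⟩ := h.gap (i + 1) D.2 ⟨W, hW, by omega⟩ ⟨p, hp, by omega⟩
    have hbF := h.bounds F hF
    have hF'' : F.1 < i + 1 ∧ i + 1 ≤ F.2 ∧ F.2 < D.2 := by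
      refine hF'.resolve_right fun hF' => ?_
      have a1 := h.one_side W hW D hD F hF hWD
      have a2 := hDmax F hF
      simp only [Overlaps] at a1 a2
      omega
    by_cases hFi : F.1 < i
    · exact ⟨F, hF, W, hW, D, hD, hWD, hWi, hFi, hF''.2⟩
    · have a4 : W.2 ≤ F.2 := by
        by_contra hlt
        exact h.one_side F hF W hW D hD ⟨by omega, by omega, by omega⟩ hWD
      have hFD : Overlaps F D := ⟨by omega, by omega, by omega⟩
      obtain ⟨G, hG, hG'⟩ := h.gap i D.2 ⟨W, hW, by omega⟩ ⟨p, hp, by omega⟩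
      rcases hG' with hG' | hG'
      · have b4 : F.2 ≤ G.2 := by
          by_contra hlt
          exact h.one_side G hG F hF D hD ⟨by omega, by omega, by omega⟩ hFD
        exact ⟨G, hG, W, hW, D, hD, hWD, hWi, hG'.1, by omega, hG'.2.2⟩
      · exfalso
        have b1 := h.one_side W hW D hD G hG hWD
        have b2 := hDmax G hG
        have b3 := hWmax G hG
        simp only [Overlaps] at b1 b2
        omega
  · left
    obtain ⟨B, hB, hWB | hBW⟩ := h.crossed W hW
    · exact absurd ⟨B, hB, hWB⟩ hcr
    · have hbB := h.bounds B hB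
      by_cases hBi : B.1 < i
      · exact ⟨B, hB, W, hW, hBW, hWi, hBi⟩
      · simp only [Overlaps] at hBW
        obtain ⟨F, hF, hF'⟩ := h.gap i W.2 ⟨W, hW, by omega⟩ ⟨p, hp, by omega⟩
        have hbF := h.bounds F hF
        have a1 := h.one_side F hF B hB W hW
        have a2 := h.one_side B hB W hW F hF
        have a3 := hWmax F hF
        simp only [Overlaps] at a1 a2
        exact ⟨F, hF, W, hW, by simp only [Overlaps]; omega⟩

end IsIntervalSystem

/-! ### Interval models of families of cuts -/

/-- The vertices whose index lies in `{a, …, b}`. -/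
def block (ι : V → ℕ) (a b : ℕ) : Finset V := Finset.univ.filter fun v => a ≤ ι v ∧ ι v ≤ b

@[simp] theorem mem_block {ι : V → ℕ} {a b : ℕ} {v : V} :
    v ∈ block ι a b ↔ a ≤ ι v ∧ ι v ≤ b := by
  simp [block]

/-- The near minimum cuts `block ι p.1 p.2`, `p ∈ I`, form an interval system. -/
structure IsIntervalModel (g : Sym2 V → ℝ) (u₀ v₀ : V) (η : ℝ) (N : ℕ) (ι : V → ℕ)
    (I : Set (ℕ × ℕ)) : Prop where
  cutSystem : IsCutSystem g u₀ v₀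
  sys : IsIntervalSystem N I
  two_le : 2 ≤ N
  index_le : ∀ v, ι v ≤ N
  surj : ∀ i ≤ N, ∃ v, ι v = i
  root : ι u₀ = 0 ∧ ι v₀ = 0
  near : ∀ p ∈ I, cutWeight g (block ι p.1 p.2) < 2 + η

/-- Two near minimum cuts that meet both `S` and its complement, and that do not meet outside of
`S`. -/
def HasTwoArms (g : Sym2 V → ℝ) (u₀ v₀ : V) (η : ℝ) (S : Finset V) : Prop :=
  ∃ M₁ M₂ : Finset V, M₁ ∩ M₂ ⊆ S ∧ ∀ M ∈ [M₁, M₂], u₀ ∉ M ∧ v₀ ∉ M ∧ (M ∩ S).Nonempty ∧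
    (M \ S).Nonempty ∧ cutWeight g M ≤ 2 + 3 * η

namespace IsIntervalModel

variable {g : Sym2 V → ℝ} {u₀ v₀ : V} {η : ℝ} {N : ℕ} {ι : V → ℕ} {I : Set (ℕ × ℕ)}

theorem block_mirror (h : IsIntervalModel g u₀ v₀ η N ι I) {a b : ℕ} (ha : 1 ≤ a) (hb : b ≤ N) :
    block (fun v => if ι v = 0 then 0 else N + 1 - ι v) (N + 1 - b) (N + 1 - a) =
      block ι a b := by
  ext v
  have := h.index_le v
  simp only [mem_block]
  split_ifs <;> omega

theorem reflect (h : IsIntervalModel g u₀ v₀ η N ι I) :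
    IsIntervalModel g u₀ v₀ η N (fun v => if ι v = 0 then 0 else N + 1 - ι v)
      (IsIntervalSystem.mirror N '' I) := by
  refine ⟨h.cutSystem, h.sys.reflect, h.two_le, fun v => ?_, fun i hi => ?_, ?_, ?_⟩
  · split_ifs <;> omega
  · by_cases h0 : i = 0
    · exact ⟨u₀, by simp [h.root.1, h0]⟩
    · obtain ⟨v, hv⟩ := h.surj (N + 1 - i) (by omega)
      refine ⟨v, ?_⟩
      split_ifs <;> omega
  · simp [h.root]
  · rintro _ ⟨p, hp, rfl⟩
    have := h.sys.bounds p hp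
    rw [IsIntervalSystem.mirror, h.block_mirror this.1 this.2.2]
    exact h.near p hp

theorem not_mem_block (h : IsIntervalModel g u₀ v₀ η N ι I) {a : ℕ} (b : ℕ) (ha : 1 ≤ a) :
    u₀ ∉ block ι a b ∧ v₀ ∉ block ι a b := by
  simp only [mem_block, h.root.1, h.root.2]
  omega

theorem two_le_cutWeight (h : IsIntervalModel g u₀ v₀ η N ι I) {a b : ℕ} (ha : 1 ≤ a)
    (hab : a ≤ b) (hb : b ≤ N) : 2 ≤ cutWeight g (block ι a b) := by
  obtain ⟨v, hv⟩ := h.surj a (hab.trans hb)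
  exact h.cutSystem.two_le _ ⟨v, mem_block.2 (by omega)⟩ (h.not_mem_block b ha).1
    (h.not_mem_block b ha).2

theorem cutWeight_union_le (h : IsIntervalModel g u₀ v₀ η N ι I) {a b c d : ℕ} (ha : 1 ≤ a)
    (hac : a < c) (hcb : c ≤ b) (hbd : b < d) (hd : d ≤ N) :
    cutWeight g (block ι a d) + 2 ≤ cutWeight g (block ι a b) + cutWeight g (block ι c d) := by
  have h1 := cutWeight_inter_add_cutWeight_union_le h.cutSystem.nonneg (block ι a b) (block ι c d)
  have e1 : block ι a b ∩ block ι c d = block ι c b := by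
    ext v
    simp only [Finset.mem_inter, mem_block]
    omega
  have e2 : block ι a b ∪ block ι c d = block ι a d := by
    ext v
    simp only [Finset.mem_union, mem_block]
    omega
  have h2 := h.two_le_cutWeight (a := c) (b := b) (by omega) hcb (by omega)
  rw [e1, e2] at h1
  linarith

theorem cutWeight_sdiff_add (h : IsIntervalModel g u₀ v₀ η N ι I) {a b c d : ℕ}
    (hac : a < c) (hcb : c ≤ b) (hbd : b < d) :
    cutWeight g (block ι a (c - 1)) + cutWeight g (block ι (b + 1) d) ≤
      cutWeight g (block ι a b) + cutWeight g (block ι c d) := by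
  have h1 := cutWeight_sdiff_add_cutWeight_sdiff_le h.cutSystem.nonneg (block ι a b) (block ι c d)
  have e1 : block ι a b \ block ι c d = block ι a (c - 1) := by
    ext v
    simp only [Finset.mem_sdiff, mem_block]
    omega
  have e2 : block ι c d \ block ι a b = block ι (b + 1) d := by
    ext v
    simp only [Finset.mem_sdiff, mem_block]
    omega
  rwa [e1, e2] at h1

/-- The union of the family is a near minimum cut. -/
theorem cutWeight_univ_le (h : IsIntervalModel g u₀ v₀ η N ι I) :
    cutWeight g (block ι 1 N) ≤ 2 + 2 * η := by
  obtain ⟨p, hp, q, hq, ⟨h1, h2, h3⟩, hp1, hqN⟩ := h.sys.exists_cover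
  have := h.cutWeight_union_le (h.sys.bounds p hp).1 h1 h2 h3 hqN.le
  rw [hp1, hqN] at this
  have hp' := h.near p hp
  have hq' := h.near q hq
  rw [hp1] at hp'
  rw [hqN] at hq'
  linarith

theorem arms_or_boundary_of_overlaps (h : IsIntervalModel g u₀ v₀ η N ι I) (hη : 0 < η)
    {p : ℕ × ℕ} (hp : p ∈ I) (hcr : ∃ q ∈ I, Overlaps p q) :
    HasTwoArms g u₀ v₀ η (block ι p.1 p.2) ∨
      (cutWeight g (block ι 1 N \ block ι p.1 p.2) ≤ 2 + 2 * η ∧ p.1 = 1) := by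
  have hbp := h.sys.bounds p hp
  have hnp := h.near p hp
  rcases h.sys.cover_or_extend hp hcr with
    ⟨q, hq, ⟨h1, h2, h3⟩, hp1, hqN⟩ | ⟨q, hq, r, hr, ⟨h1, h2, h3⟩, ⟨h4, h5, h6⟩, h7, h8⟩
  · right
    refine ⟨?_, hp1⟩
    have hnq := h.near q hq
    have e := h.cutWeight_sdiff_add h1 h2 h3
    have e2 := h.two_le_cutWeight (a := p.1) (b := q.1 - 1) (by omega) (by omega) (by omega)
    have e3 : block ι 1 N \ block ι p.1 p.2 = block ι (p.2 + 1) q.2 := by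
      ext v
      simp only [Finset.mem_sdiff, mem_block]
      omega
    rw [e3]
    linarith
  · left
    have hbq := h.sys.bounds q hq
    have hbr := h.sys.bounds r hr
    have hnq := h.near q hq
    have hnr := h.near r hr
    have e := h.cutWeight_sdiff_add h4 h5 h6
    have e2 := h.two_le_cutWeight (a := r.2 + 1) (b := q.2) (by omega) (by omega) (by omega)
    obtain ⟨x1, hx1⟩ := h.surj q.1 (by omega)
    obtain ⟨x2, hx2⟩ := h.surj (p.2 + 1) (by omega)
    obtain ⟨x3, hx3⟩ := h.surj p.1 (by omega)
    obtain ⟨x4, hx4⟩ := h.surj r.1 (by omega)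
    -- The arms are q and r ∖ q. They are disjoint, and uncrossing r with q bounds the second by 2 +
    -- 2η.
    refine ⟨block ι q.1 q.2, block ι r.1 (q.1 - 1), fun v hv => ?_, ?_⟩
    · simp only [Finset.mem_inter, mem_block] at hv
      omega
    · simp only [List.mem_cons, List.not_mem_nil, or_false, forall_eq_or_imp, forall_eq]
      refine ⟨⟨(h.not_mem_block _ hbq.1).1, (h.not_mem_block _ hbq.1).2, ⟨x1, ?_⟩, ⟨x2, ?_⟩, ?_⟩,
        (h.not_mem_block _ hbr.1).1, (h.not_mem_block _ hbr.1).2, ⟨x3, ?_⟩, ⟨x4, ?_⟩, ?_⟩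
      all_goals first
        | linarith
        | (simp only [Finset.mem_inter, Finset.mem_sdiff, mem_block]
           omega)

theorem arms_or_boundary (h : IsIntervalModel g u₀ v₀ η N ι I) (hη : 0 < η)
    {p : ℕ × ℕ} (hp : p ∈ I) :
    HasTwoArms g u₀ v₀ η (block ι p.1 p.2) ∨
      (cutWeight g (block ι 1 N \ block ι p.1 p.2) ≤ 2 + 2 * η ∧ (p.1 = 1 ∨ p.2 = N)) := by
  have hbp := h.sys.bounds p hp
  obtain ⟨q, hq, hpq | hqp⟩ := h.sys.crossed p hp
  · exact (h.arms_or_boundary_of_overlaps hη hp ⟨q, hq, hpq⟩).imp id fun h => ⟨h.1, Or.inl h.2⟩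
  · have hbq := h.sys.bounds q hq
    have h' := h.reflect.arms_or_boundary_of_overlaps hη ⟨p, hp, rfl⟩
      ⟨_, ⟨q, hq, rfl⟩, by simp only [IsIntervalSystem.mirror, Overlaps] at *; omega⟩
    have e := h.block_mirror (a := 1) (b := N) le_rfl le_rfl
    rw [Nat.add_sub_cancel_left, Nat.add_sub_cancel] at e
    simp only [IsIntervalSystem.mirror] at h'
    rw [h.block_mirror hbp.1 hbp.2.2, e] at h'
    exact h'.imp id fun h => ⟨h.1, Or.inr (by omega)⟩

theorem cutWeight_univ_sdiff_first_le (h : IsIntervalModel g u₀ v₀ η N ι I) (hη : 0 < η) :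
    cutWeight g (block ι 1 N \ block ι 1 1) ≤ 2 + 2 * η := by
  have e : block ι 1 N \ block ι 1 1 = block ι 2 N := by
    ext v
    simp only [Finset.mem_sdiff, mem_block]
    omega
  rw [e]
  rcases h.sys.exists_cover_two h.two_le with
    ⟨p, hp, h1, h2⟩ | ⟨p, hp, q, hq, ⟨h1, h2, h3⟩, h4, h5⟩
  · have := h.near p hp
    rw [h1, h2] at this
    linarith
  · have := h.cutWeight_union_le (h.sys.bounds p hp).1 h1 h2 h3 h5.le
    have hp' := h.near p hp
    have hq' := h.near q hq
    rw [h4, h5] at this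
    rw [h4] at hp'
    rw [h5] at hq'
    linarith

theorem cutWeight_univ_sdiff_last_le (h : IsIntervalModel g u₀ v₀ η N ι I) (hη : 0 < η) :
    cutWeight g (block ι 1 N \ block ι N N) ≤ 2 + 2 * η := by
  have h' := h.reflect.cutWeight_univ_sdiff_first_le hη
  have h2 := h.two_le
  have e := h.block_mirror (a := 1) (b := N) le_rfl le_rfl
  have e' := h.block_mirror (a := N) (b := N) (by omega) le_rfl
  simp only [Nat.add_sub_cancel_left, Nat.add_sub_cancel] at e e'
  rwa [e, e'] at h'

/-- The constant 3η comes from the case of three cuts: a union of weight at most 2 + 2η is uncrossed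
with one further cut. -/
theorem exists_left_arm (h : IsIntervalModel g u₀ v₀ η N ι I) (hη : 0 < η) {i : ℕ} (hi : 2 ≤ i)
    (hiN : i ≤ N) : ∃ a, 1 ≤ a ∧ a < i ∧ cutWeight g (block ι a i) ≤ 2 + 3 * η := by
  rcases h.sys.hasLeftArm hi hiN with
    ⟨p, hp, hpi⟩ | ⟨p, hp, q, hq, ⟨h1, h2, h3⟩, h4, h5⟩ |
      ⟨p, hp, q, hq, r, hr, ⟨h1, h2, h3⟩, h4, h5, h6, h7⟩
  · have hb := h.sys.bounds p hp
    have hn := h.near p hp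
    rw [hpi] at hn
    exact ⟨p.1, hb.1, by omega, by linarith⟩
  · have hb := h.sys.bounds p hp
    have hb' := h.sys.bounds q hq
    have hn := h.near p hp
    have hn' := h.near q hq
    have e := h.cutWeight_sdiff_add h1 h2 h3
    have e2 := h.two_le_cutWeight (a := p.2 + 1) (b := q.2) (by omega) (by omega) (by omega)
    rw [h4, Nat.add_sub_cancel] at e
    rw [h4] at hn'
    exact ⟨p.1, hb.1, h5, by linarith⟩
  · have hb := h.sys.bounds p hp
    have hb' := h.sys.bounds q hq
    have hb'' := h.sys.bounds r hr
    have hn := h.near p hp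
    have hn' := h.near q hq
    have hn'' := h.near r hr
    have e1 := h.cutWeight_union_le hb'.1 h1 h2 h3 hb''.2.2
    have e := h.cutWeight_sdiff_add (a := p.1) (b := p.2) (c := q.1) (d := r.2) (by omega)
      (by omega) (by omega)
    have e2 := h.two_le_cutWeight (a := p.2 + 1) (b := r.2) (by omega) (by omega) (by omega)
    rw [h4, Nat.add_sub_cancel] at e
    rw [h4] at hn' e1
    exact ⟨p.1, hb.1, h5, by linarith⟩

theorem exists_right_arm (h : IsIntervalModel g u₀ v₀ η N ι I) (hη : 0 < η) {i : ℕ} (hi : 1 ≤ i)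
    (hiN : i < N) : ∃ b, i < b ∧ b ≤ N ∧ cutWeight g (block ι i b) ≤ 2 + 3 * η := by
  obtain ⟨a, ha1, ha2, ha3⟩ := h.reflect.exists_left_arm hη (i := N + 1 - i) (by omega) (by omega)
  refine ⟨N + 1 - a, by omega, by omega, ?_⟩
  rw [← h.block_mirror hi (b := N + 1 - a) (by omega)]
  rwa [show N + 1 - (N + 1 - a) = a by omega]

theorem hasTwoArms_singleton (h : IsIntervalModel g u₀ v₀ η N ι I) (hη : 0 < η) {i : ℕ}
    (hi : 2 ≤ i) (hiN : i < N) : HasTwoArms g u₀ v₀ η (block ι i i) := by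
  obtain ⟨a, ha1, ha2, ha3⟩ := h.exists_left_arm hη hi hiN.le
  obtain ⟨b, hb1, hb2, hb3⟩ := h.exists_right_arm hη (by omega : 1 ≤ i) hiN
  obtain ⟨x, hx⟩ := h.surj i (by omega)
  obtain ⟨y, hy⟩ := h.surj a (by omega)
  obtain ⟨z, hz⟩ := h.surj b (by omega)
  refine ⟨block ι a i, block ι i b, fun v hv => ?_, ?_⟩
  · simp only [Finset.mem_inter, mem_block] at hv ⊢
    omega
  · simp only [List.mem_cons, List.not_mem_nil, or_false, forall_eq_or_imp, forall_eq]
    refine ⟨⟨(h.not_mem_block _ ha1).1, (h.not_mem_block _ ha1).2, ⟨x, ?_⟩, ⟨y, ?_⟩, ha3⟩,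
      (h.not_mem_block _ (by omega)).1, (h.not_mem_block _ (by omega)).2, ⟨x, ?_⟩, ⟨z, ?_⟩, hb3⟩
    all_goals
      simp only [Finset.mem_inter, Finset.mem_sdiff, mem_block]
      omega

end IsIntervalModel

/-! ### The interval model of a polygon without inside atoms -/

namespace PolygonRep

variable {g : Sym2 V → ℝ} {u₀ v₀ : V} {η : ℝ} {C : Set (Finset V)}

/-- Without a cycle around it an atom is an outside atom, so every vertex gets the position of its
atom. -/
theorem exists_index (P : PolygonRep C) (hin : ∀ a, ¬ AvoidedByCycle C a) :
    ∃ ι : V → ZMod P.m, ∀ v k, v ∈ P.outer k ↔ ι v = k := by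
  have h : ∀ v, ∃ k, P.outer k = atomOf C v := fun v =>
    not_not.1 ((not_congr (P.inside_iff _ ⟨v, rfl⟩)).2 (hin _))
  choose ι hι using h
  refine ⟨ι, fun v k => ⟨fun hv => P.outer_injective ?_, ?_⟩⟩
  · rw [hι, (P.outer_atom k).eq_atomOf hv]
  · rintro rfl
    rw [hι]
    exact self_mem_atomOf C v

/-- The first index of a cut. -/
def lo (P : PolygonRep C) (S : Finset V) : ℕ := (P.diagFst S).val

/-- The last index of a cut. -/
def hi (P : PolygonRep C) (S : Finset V) : ℕ :=
  (P.diagFst S).val + (P.diagSnd S - P.diagFst S).val - 1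

/-- The arc of S avoids the side of the root, so it does not wrap around 0. Diagonals are not sides
of the polygon, which makes the interval longer than one atom. -/
theorem eq_block (P : PolygonRep C) {ι : V → ZMod P.m} (hι : ∀ v k, v ∈ P.outer k ↔ ι v = k)
    (hroot : u₀ ∈ P.outer 0) {S : Finset V} (hS : S ∈ C) (hu : u₀ ∉ S) :
    S = block (fun v => (ι v).val) (P.lo S) (P.hi S) ∧
      1 ≤ P.lo S ∧ P.lo S < P.hi S ∧ P.hi S ≤ P.m - 1 := by
  have h0 : ¬ (0 - P.diagFst S).val < (P.diagSnd S - P.diagFst S).val := fun h =>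
    hu ((P.outer_subset_iff S hS 0).2 h hroot)
  have hm := P.three_le
  have h1 := zmod_val_sub 0 (P.diagFst S)
  have h2 := ZMod.val_lt (P.diagFst S)
  have h3 := ZMod.val_lt (P.diagSnd S - P.diagFst S)
  have h4 : (P.diagSnd S - P.diagFst S).val ≠ 0 := by
    rw [Ne, ZMod.val_eq_zero, sub_eq_zero]
    exact (P.diag_ne S hS).1.symm
  have h5 : (P.diagSnd S - P.diagFst S).val ≠ 1 := by
    rw [← P.one_val]
    intro h
    have := ZMod.val_injective _ h
    exact (P.diag_ne S hS).2.1 (by linear_combination -this)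
  rw [ZMod.val_zero] at h1
  refine ⟨?_, by simp only [lo, hi]; omega⟩
  ext v
  have hv : v ∈ P.outer (ι v) := (hι v _).2 rfl
  have h6 : v ∈ S ↔ P.outer (ι v) ⊆ S := ⟨P.outer_subset_of_mem hS hv, fun h => h hv⟩
  have h7 := zmod_val_sub (ι v) (P.diagFst S)
  have h8 := ZMod.val_lt (ι v)
  have h9 := ZMod.val_lt (ι v - P.diagFst S)
  rw [h6, P.outer_subset_iff S hS, mem_block]
  simp only [lo, hi]
  omega

theorem overlaps_of_crosses (P : PolygonRep C) {ι : V → ZMod P.m}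
    (hι : ∀ v k, v ∈ P.outer k ↔ ι v = k) (hroot : u₀ ∈ P.outer 0) {A B : Finset V} (hA : A ∈ C)
    (hB : B ∈ C) (huA : u₀ ∉ A) (huB : u₀ ∉ B) (h : Crosses A B) :
    Overlaps (P.lo A, P.hi A) (P.lo B, P.hi B) ∨ Overlaps (P.lo B, P.hi B) (P.lo A, P.hi A) := by
  obtain ⟨⟨a, ha⟩, ⟨b, hb⟩, ⟨c, hc⟩, -⟩ := crosses_iff.1 h
  rw [(P.eq_block hι hroot hA huA).1, (P.eq_block hι hroot hB huB).1] at ha hb hc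
  simp only [mem_block] at ha hb hc
  simp only [Overlaps]
  omega

theorem isIntervalModel (P : PolygonRep C) (hg : IsCutSystem g u₀ v₀)
    (hC : IsOneSidedFamily g u₀ v₀ η C) (hroot : u₀ ∈ P.outer 0) {ι : V → ZMod P.m}
    (hι : ∀ v k, v ∈ P.outer k ↔ ι v = k) :
    IsIntervalModel g u₀ v₀ η (P.m - 1) (fun v => (ι v).val)
      ((fun S => (P.lo S, P.hi S)) '' C) := by
  have hm := P.three_le
  have hblock := fun S (hS : S ∈ C) => P.eq_block hι hroot hS (hC.avoid S hS).1
  have hmem : ∀ S ∈ C, ∀ v, v ∈ S ↔ P.lo S ≤ (ι v).val ∧ (ι v).val ≤ P.hi S := fun S hS v => by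
    conv_lhs => rw [(hblock S hS).1]
    exact mem_block
  have hu : ι u₀ = 0 := (hι _ _).1 hroot
  have hv0 : v₀ ∈ P.outer 0 := by
    rw [(P.outer_atom 0).eq_atomOf hroot, mem_atomOf]
    exact fun S hS => iff_of_false (hC.avoid S hS).1 (hC.avoid S hS).2
  have hv : ι v₀ = 0 := (hι _ _).1 hv0
  have hlt : ∀ v, (ι v).val ≤ P.m - 1 := fun v => Nat.le_sub_one_of_lt (ZMod.val_lt _)
  have hsurj : ∀ i ≤ P.m - 1, ∃ v, (ι v).val = i := by
    intro i hi
    obtain ⟨v, hv⟩ := (P.outer_atom (i : ZMod P.m)).nonempty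
    exact ⟨v, by rw [(hι _ _).1 hv, ZMod.val_cast_of_lt (by omega)]⟩
  have hsep : ∀ v w, (ι v).val ≠ (ι w).val → ∃ S ∈ C, ¬ (v ∈ S ↔ w ∈ S) := by
    intro v w hne
    by_contra! h
    have hv := (hι v _).2 rfl
    have hw : w ∈ P.outer (ι v) := by
      rw [(P.outer_atom _).eq_atomOf hv]
      exact mem_atomOf.2 h
    exact hne (congrArg ZMod.val ((hι _ _).1 hw).symm)
  have hover : ∀ A ∈ C, ∀ B ∈ C, Crosses A B →
      Overlaps (P.lo A, P.hi A) (P.lo B, P.hi B) ∨ Overlaps (P.lo B, P.hi B) (P.lo A, P.hi A) := by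
    exact fun A hA B hB => P.overlaps_of_crosses hι hroot hA hB (hC.avoid A hA).1 (hC.avoid B hB).1
  have hcross : ∀ A ∈ C, ∀ B ∈ C, Overlaps (P.lo A, P.hi A) (P.lo B, P.hi B) → Crosses A B := by
    rintro A hA B hB ⟨h1, h2, h3⟩
    obtain ⟨-, hA1, hA2, hA3⟩ := hblock A hA
    obtain ⟨-, hB1, hB2, hB3⟩ := hblock B hB
    dsimp only at h1 h2 h3
    obtain ⟨a, ha⟩ := hsurj (P.lo B) (by omega)
    obtain ⟨b, hb⟩ := hsurj (P.lo A) (by omega)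
    obtain ⟨c, hc⟩ := hsurj (P.hi B) (by omega)
    refine crosses_iff.2 ⟨⟨a, ?_⟩, ⟨b, ?_⟩, ⟨c, ?_⟩, u₀, (hC.avoid A hA).1, (hC.avoid B hB).1⟩
    all_goals
      simp only [hmem A hA, hmem B hB]
      omega
  refine ⟨hg, ⟨?_, ?_, ?_, ?_, ?_, ?_, ?_⟩, by omega, hlt, hsurj,
    ⟨by rw [hu, ZMod.val_zero], by rw [hv, ZMod.val_zero]⟩, ?_⟩
  · rintro _ ⟨S, hS, rfl⟩
    exact (hblock S hS).2
  · rintro _ ⟨S, hS, rfl⟩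
    obtain ⟨B, hB, hSB⟩ := hC.exists_crosses hS
    exact ⟨_, ⟨B, hB, rfl⟩, hover S hS B hB hSB⟩
  -- Cuts overlapping S from opposite sides can only meet inside S, against the vertex of (A ∩ B) ∖
  -- S that `CrossedAlike` provides.
  · rintro _ ⟨A, hA, rfl⟩ _ ⟨S, hS, rfl⟩ _ ⟨B, hB, rfl⟩ h1 h2
    obtain ⟨-, ⟨v, hv⟩, -⟩ := hC.alike S hS A hA B hB (hcross A hA S hS h1)
      (hcross S hS B hB h2).symm
    simp only [Finset.mem_sdiff, Finset.mem_inter, hmem A hA, hmem B hB, hmem S hS] at hv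
    simp only [Overlaps] at h1 h2
    omega
  · rintro a b ⟨_, ⟨S, hS, rfl⟩, h1⟩ ⟨_, ⟨B, hB, rfl⟩, h2⟩
    by_contra! hno
    have := hC.connected (fun X => a ≤ P.lo X ∧ P.hi X ≤ b) (fun X hX Y hY hXY hQ => ?_) S hS B hB
      h1
    · dsimp only at h2
      omega
    · have h3 := hno _ ⟨Y, hY, rfl⟩
      have h4 := hover X hX Y hY hXY
      simp only [Overlaps] at h3 h4
      omega
  · intro i h1 h2
    obtain ⟨v, hv⟩ := hsurj i (by omega)
    obtain ⟨w, hw⟩ := hsurj (i + 1) (by omega)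
    obtain ⟨S, hS, h3⟩ := hsep v w (by omega)
    refine ⟨_, ⟨S, hS, rfl⟩, ?_⟩
    rw [hmem S hS, hmem S hS] at h3
    dsimp only
    omega
  · obtain ⟨v, hv⟩ := hsurj 0 (by omega)
    obtain ⟨w, hw⟩ := hsurj 1 (by omega)
    obtain ⟨S, hS, h3⟩ := hsep v w (by omega)
    have := (hblock S hS).2
    refine ⟨_, ⟨S, hS, rfl⟩, ?_⟩
    rw [hmem S hS, hmem S hS] at h3
    dsimp only
    omega
  · obtain ⟨v, hv⟩ := hsurj 0 (by omega)
    obtain ⟨w, hw⟩ := hsurj (P.m - 1) (by omega)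
    obtain ⟨S, hS, h3⟩ := hsep v w (by omega)
    have := (hblock S hS).2
    refine ⟨_, ⟨S, hS, rfl⟩, ?_⟩
    rw [hmem S hS, hmem S hS] at h3
    dsimp only
    omega
  · rintro _ ⟨S, hS, rfl⟩
    dsimp only
    rw [← (hblock S hS).1]
    exact hC.near S hS

end PolygonRep

/-! ### Random spanning trees -/

open scoped Classical in
/-- The probability of an event. -/
noncomputable def treeProb (μ : Finset (Sym2 V) → ℝ) (Q : Finset (Sym2 V) → Prop) : ℝ :=
  ∑ T, if Q T then μ T else 0

/-- The number of edges that a tree with edge set `T` lacks inside `M`. -/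
noncomputable def deficiency (T : Finset (Sym2 V)) (M : Finset V) : ℝ :=
  M.card - 1 - pairWeight (restrictTo T fun _ => 1) M M / 2

theorem restrictTo_one_nonneg (T : Finset (Sym2 V)) (e : Sym2 V) :
    0 ≤ restrictTo T (fun _ => (1 : ℝ)) e := by
  rw [restrictTo]
  split_ifs <;> norm_num

section Tree

variable {E T : Finset (Sym2 V)}

theorem IsSpanningTree.deficiency_nonneg (hE : ∀ e ∈ E, ¬ e.IsDiag) (hT : IsSpanningTree E T)
    {M : Finset V} (hM : M.Nonempty) : 0 ≤ deficiency T M := by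
  have := pairWeight_self_le_of_isAcyclic (fun e he => hE e (hT.1 he)) hT.2.isAcyclic hM
  rw [deficiency]
  linarith

/-- X and Y contain at most |X| - 1 and |Y| - 1 tree edges, so all but that many of the |X ∪ Y| - 1
- `deficiency` edges inside X ∪ Y join X to Y. -/
theorem IsSpanningTree.one_sub_deficiency_le (hE : ∀ e ∈ E, ¬ e.IsDiag) (hT : IsSpanningTree E T)
    {X Y : Finset V} (hXY : Disjoint X Y) (hX : X.Nonempty) (hY : Y.Nonempty) :
    1 - deficiency T (X ∪ Y) ≤ pairWeight (restrictTo T fun _ => 1) X Y := by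
  have h1 := hT.deficiency_nonneg hE hX
  have h2 := hT.deficiency_nonneg hE hY
  rw [deficiency] at h1 h2 ⊢
  rw [pairWeight_union_self _ hXY, Finset.card_union_of_disjoint hXY]
  push_cast
  linarith

/-- An edge of δ(S) inside both M₁ and M₂ would have its outer endpoint in M₁ ∩ M₂ ⊆ S, so the two
sums range over disjoint parts of δ(S). -/
theorem pairWeight_add_pairWeight_le {g : Sym2 V → ℝ} (hg : ∀ e, 0 ≤ g e) {S M₁ M₂ : Finset V}
    (h : M₁ ∩ M₂ ⊆ S) :
    pairWeight g (M₁ ∩ S) (M₁ \ S) + pairWeight g (M₂ ∩ S) (M₂ \ S) ≤ cutWeight g S := by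
  simp only [pairWeight_eq_sum_ite, cutWeight_eq_sum_ite, ← Finset.sum_add_distrib]
  refine Finset.sum_le_sum fun u _ => Finset.sum_le_sum fun v _ => ?_
  have h1 := hg s(u, v)
  have h2 : v ∈ M₁ → v ∈ M₂ → v ∈ S := fun a b => h (Finset.mem_inter.2 ⟨a, b⟩)
  by_cases a : u ∈ S <;> by_cases b : v ∈ S <;> by_cases c : v ∈ M₁ <;> by_cases d : v ∈ M₂ <;>
    by_cases e : u ∈ M₁ <;> by_cases f : u ∈ M₂ <;> simp_all

-- The arms give δ(S)_T ≥ 2 - d₁ - d₂. An odd value is at least 3, or it is 1 and forces d₁ + d₂ ≥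
-- 1; either way the right side is at least 1.
open scoped Classical in
theorem IsSpanningTree.odd_indicator_le (hE : ∀ e ∈ E, ¬ e.IsDiag) (hT : IsSpanningTree E T)
    {S M₁ M₂ : Finset V} (h : M₁ ∩ M₂ ⊆ S) (h1 : (M₁ ∩ S).Nonempty) (h1' : (M₁ \ S).Nonempty)
    (h2 : (M₂ ∩ S).Nonempty) (h2' : (M₂ \ S).Nonempty) :
    (if Odd (delta E S ∩ T).card then (1 : ℝ) else 0) ≤
      cutWeight (restrictTo T fun _ => 1) S - 2 + 2 * (deficiency T M₁ + deficiency T M₂) := by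
  have key : ∀ M : Finset V, (M ∩ S).Nonempty → (M \ S).Nonempty → 0 ≤ deficiency T M ∧
      1 - deficiency T M ≤ pairWeight (restrictTo T fun _ => 1) (M ∩ S) (M \ S) := by
    intro M hM hM'
    have hd : Disjoint (M ∩ S) (M \ S) := Finset.disjoint_left.2 fun v h1 h2 => by simp_all
    have := hT.one_sub_deficiency_le hE hd hM hM'
    rw [Finset.union_comm, Finset.sdiff_union_inter] at this
    exact ⟨hT.deficiency_nonneg hE (hM.mono Finset.inter_subset_left), this⟩
  obtain ⟨a1, a2⟩ := key M₁ h1 h1'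
  obtain ⟨b1, b2⟩ := key M₂ h2 h2'
  have hle := pairWeight_add_pairWeight_le (restrictTo_one_nonneg T) h
  rw [← card_delta_inter hT.1] at hle ⊢
  generalize (delta E S ∩ T).card = n at hle ⊢
  split_ifs with hn
  · rcases Nat.lt_or_ge n 2 with h | h
    · have h1 : (n : ℝ) ≤ 1 := by exact_mod_cast Nat.le_of_lt_succ h
      have h2 : (1 : ℝ) ≤ n := by exact_mod_cast hn.pos
      linarith
    · have h3 : 3 ≤ n := by
        obtain ⟨k, rfl⟩ := hn
        omega
      have h3 : (3 : ℝ) ≤ n := by exact_mod_cast h3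
      linarith
  · linarith

open scoped Classical in
theorem IsSpanningTree.even_indicator_le (hE : ∀ e ∈ E, ¬ e.IsDiag) (hT : IsSpanningTree E T)
    {X Y : Finset V} (hXY : Disjoint X Y) (hX : X.Nonempty) (hY : Y.Nonempty) :
    (if Even (edgesBetween E X Y ∩ T).card then (1 : ℝ) else 0) ≤
      pairWeight (restrictTo T fun _ => 1) X Y - 1 + 2 * deficiency T (X ∪ Y) := by
  have h1 := hT.one_sub_deficiency_le hE hXY hX hY
  have h2 := hT.deficiency_nonneg hE (hX.mono (Finset.subset_union_left (s₂ := Y)))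
  rw [← card_edgesBetween_inter hT.1 hXY] at h1 ⊢
  generalize (edgesBetween E X Y ∩ T).card = n at h1 ⊢
  split_ifs with hn
  · rcases Nat.eq_zero_or_pos n with rfl | h
    · push_cast at h1 ⊢
      linarith
    · have h3 : 2 ≤ n := by
        obtain ⟨k, rfl⟩ := hn
        omega
      have h3 : (2 : ℝ) ≤ n := by exact_mod_cast h3
      linarith
  · linarith

end Tree

namespace IsTreeDistribution

variable {E : Finset (Sym2 V)} {x : Sym2 V → ℝ} {μ : Finset (Sym2 V) → ℝ}

theorem expect_restrictTo (hμ : IsTreeDistribution E x μ) (e : Sym2 V) :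
    ∑ T, μ T * restrictTo T (fun _ => 1) e = restrictTo E x e := by
  simp only [restrictTo, mul_ite, mul_one, mul_zero]
  split_ifs with he
  · rw [← hμ.marginal e he]
  · refine Finset.sum_eq_zero fun T _ => ?_
    split_ifs with h
    · by_contra h0
      exact he ((hμ.support T h0).1 h)
    · rfl

theorem expect_pairWeight (hμ : IsTreeDistribution E x μ) (A B : Finset V) :
    ∑ T, μ T * pairWeight (restrictTo T fun _ => 1) A B = pairWeight (restrictTo E x) A B := by
  simp only [pairWeight, Finset.mul_sum]
  rw [Finset.sum_comm]
  refine Finset.sum_congr rfl fun u _ => ?_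
  rw [Finset.sum_comm]
  exact Finset.sum_congr rfl fun v _ => hμ.expect_restrictTo _

/-- The degrees in M sum to 2|M|, so the expected number of tree edges inside M is |M| - x(δ(M))/2.
-/
theorem expect_deficiency (hμ : IsTreeDistribution E x μ) {u₀ v₀ : V}
    (hg : IsCutSystem (restrictTo E x) u₀ v₀) {M : Finset V} (hu : u₀ ∉ M) (hv : v₀ ∉ M) :
    ∑ T, μ T * deficiency T M = cutWeight (restrictTo E x) M / 2 - 1 := by
  have h1 := hμ.expect_pairWeight M M
  have h2 : ∑ u ∈ M, ∑ w, restrictTo E x s(u, w) = M.card * 2 := by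
    rw [Finset.sum_congr rfl fun u hu' => hg.degree u (fun h => hu (h ▸ hu'))
      fun h => hv (h ▸ hu'), Finset.sum_const, nsmul_eq_mul]
  rw [pairWeight_self, h2] at h1
  have h3 : ∑ T, μ T * deficiency T M = (∑ T, μ T) * (M.card - 1) -
      (∑ T, μ T * pairWeight (restrictTo T fun _ => 1) M M) / 2 := by
    rw [Finset.sum_mul, Finset.sum_div, ← Finset.sum_sub_distrib]
    refine Finset.sum_congr rfl fun T _ => ?_
    rw [deficiency]
    ring
  rw [h3, hμ.total, h1]
  ring

/-- An event whose indicator is at most `F` on spanning trees has probability at most the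
expectation of `F`. -/
theorem treeProb_le (hμ : IsTreeDistribution E x μ) {Q : Finset (Sym2 V) → Prop}
    [DecidablePred Q] {F : Finset (Sym2 V) → ℝ}
    (h : ∀ T, IsSpanningTree E T → (if Q T then (1 : ℝ) else 0) ≤ F T) :
    treeProb μ Q ≤ ∑ T, μ T * F T := by
  refine Finset.sum_le_sum fun T _ => ?_
  by_cases h0 : μ T = 0
  · simp [h0]
  · have := mul_le_mul_of_nonneg_left (h T (hμ.support T h0)) (hμ.nonneg T)
    by_cases hQ : Q T
    · rw [if_pos hQ] at this ⊢
      linarith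
    · rw [if_neg hQ] at this ⊢
      linarith

/-- The mean of δ(S)_T - 2 is at most η, and each arm has expected deficiency at most 3η/2, counted
twice: η + 2 · 3η = 7η. -/
theorem treeProb_odd_le (hμ : IsTreeDistribution E x μ) (hE : ∀ e ∈ E, ¬ e.IsDiag) {u₀ v₀ : V}
    {η : ℝ} (hg : IsCutSystem (restrictTo E x) u₀ v₀) {S : Finset V}
    (hS : cutWeight (restrictTo E x) S ≤ 2 + η) (h : HasTwoArms (restrictTo E x) u₀ v₀ η S) :
    treeProb μ (fun T => Odd (delta E S ∩ T).card) ≤ 7 * η := by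
  obtain ⟨M₁, M₂, hM, h⟩ := h
  simp only [List.mem_cons, List.not_mem_nil, or_false, forall_eq_or_imp, forall_eq] at h
  obtain ⟨⟨a1, a2, a3, a4, a5⟩, b1, b2, b3, b4, b5⟩ := h
  refine (hμ.treeProb_le fun T hT => hT.odd_indicator_le hE hM a3 a4 b3 b4).trans ?_
  have h1 := hμ.expect_deficiency hg a1 a2
  have h2 := hμ.expect_deficiency hg b1 b2
  have h3 := hμ.expect_pairWeight S Sᶜ
  have h4 : ∑ T, μ T * (cutWeight (restrictTo T fun _ => 1) S - 2 +
      2 * (deficiency T M₁ + deficiency T M₂)) =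
      ∑ T, μ T * pairWeight (restrictTo T fun _ => 1) S Sᶜ - (∑ T, μ T) * 2 +
        2 * (∑ T, μ T * deficiency T M₁ + ∑ T, μ T * deficiency T M₂) := by
    rw [Finset.sum_mul, ← Finset.sum_add_distrib, Finset.mul_sum, ← Finset.sum_sub_distrib,
      ← Finset.sum_add_distrib]
    refine Finset.sum_congr rfl fun T _ => ?_
    rw [cutWeight]
    ring
  rw [h4, h1, h2, h3, hμ.total]
  rw [cutWeight] at hS
  linarith

/-- The mean of E(S, U ∖ S)_T is (x(δ(S)) + x(δ(U ∖ S)) - x(δ(U)))/2 and 2 · `deficiency` has mean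
x(δ(U)) - 2. The sum minus 1 is at most 3η/2 + η. -/
theorem treeProb_even_le (hμ : IsTreeDistribution E x μ) (hE : ∀ e ∈ E, ¬ e.IsDiag) {u₀ v₀ : V}
    {η : ℝ} (hg : IsCutSystem (restrictTo E x) u₀ v₀) {S U : Finset V} (hSU : S ⊆ U)
    (hS : S.Nonempty) (hU : (U \ S).Nonempty) (hu : u₀ ∉ U) (hv : v₀ ∉ U)
    (h1 : cutWeight (restrictTo E x) S ≤ 2 + η)
    (h2 : cutWeight (restrictTo E x) (U \ S) ≤ 2 + 2 * η)
    (h3 : cutWeight (restrictTo E x) U ≤ 2 + 2 * η) :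
    treeProb μ (fun T => Even (edgesBetween E S (U \ S) ∩ T).card) ≤ 5 / 2 * η := by
  have hd : Disjoint S (U \ S) := Finset.disjoint_sdiff
  have e : S ∪ U \ S = U := Finset.union_sdiff_of_subset hSU
  refine (hμ.treeProb_le fun T hT => hT.even_indicator_le hE hd hS hU).trans ?_
  rw [e]
  have a1 := hμ.expect_deficiency hg hu hv
  have a2 := hμ.expect_pairWeight S (U \ S)
  have a3 := cutWeight_union (restrictTo E x) hd
  rw [e] at a3
  have h4 : ∑ T, μ T * (pairWeight (restrictTo T fun _ => 1) S (U \ S) - 1 +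
      2 * deficiency T U) =
      ∑ T, μ T * pairWeight (restrictTo T fun _ => 1) S (U \ S) - (∑ T, μ T) * 1 +
        2 * ∑ T, μ T * deficiency T U := by
    rw [Finset.sum_mul, Finset.mul_sum, ← Finset.sum_sub_distrib, ← Finset.sum_add_distrib]
    exact Finset.sum_congr rfl fun T _ => by ring
  rw [h4, a1, a2, hμ.total]
  linarith

end IsTreeDistribution

/-! ### Edges between different components -/

theorem nested_of_not_crosses {A B : Finset V} {u₀ : V} (hA : u₀ ∉ A) (hB : u₀ ∉ B)
    (h : ¬ Crosses A B) : Disjoint A B ∨ A ⊆ B ∨ B ⊆ A := by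
  by_contra! hne
  obtain ⟨h1, h2, h3⟩ := hne
  exact h ⟨Finset.not_disjoint_iff_nonempty_inter.1 h1, Finset.sdiff_nonempty.2 h2,
    Finset.sdiff_nonempty.2 h3, u₀, by simp [hA, hB]⟩

/-- Containment in B spreads along crossings: if Y crosses X ⊆ B, then Y does not cross B, meets B,
and does not contain B because it misses part of X. -/
theorem IsComponent.subset_of_subset {F C : Set (Finset V)} (hC : IsComponent F C) {u₀ : V}
    (hF : ∀ S ∈ F, u₀ ∉ S) {A B : Finset V} (hA : A ∈ C) (hB : B ∈ F) (hBC : B ∉ C)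
    (hAB : A ⊆ B) : ∀ A' ∈ C, A' ⊆ B := by
  refine fun A' hA' => hC.connected (· ⊆ B) (fun X hX Y hY hXY hXB => ?_) A hA A' hA' hAB
  obtain ⟨⟨v, hv⟩, ⟨w, hw⟩, -⟩ := hXY
  simp only [Finset.mem_inter, Finset.mem_sdiff] at hv hw
  rcases nested_of_not_crosses (hF Y (hC.subset hY)) (hF B hB)
    (fun h => hBC (hC.mem_of_crosses hY hB h)) with h | h | h
  · exact absurd (hXB hv.1) (Finset.disjoint_left.1 h hv.2)
  · exact h
  · exact absurd (h (hXB hw.1)) hw.2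

/-- Two vertices that are covered and separated by two components determine the component. -/
theorem IsComponent.eq_of_separates {F C D : Set (Finset V)} (hC : IsComponent F C)
    (hD : IsComponent F D) {u₀ : V} (hF : ∀ S ∈ F, u₀ ∉ S) {u v : V}
    (huC : ∃ S ∈ C, u ∈ S) (hvC : ∃ S ∈ C, v ∈ S) (huD : ∃ S ∈ D, u ∈ S) (hvD : ∃ S ∈ D, v ∈ S)
    (hsC : ∃ S ∈ C, ¬ (u ∈ S ↔ v ∈ S)) (hsD : ∃ S ∈ D, ¬ (u ∈ S ↔ v ∈ S)) : C = D := by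
  by_contra hne
  have hCD : ∀ A ∈ C, A ∉ D := fun A h h' => hne (hC.eq_of_mem hD h h')
  have hDC : ∀ B ∈ D, B ∉ C := fun B h h' => hCD B h' h
  have habsC : ∀ A ∈ C, ∀ B ∈ D, A ⊆ B → ∀ A' ∈ C, A' ⊆ B := fun A hA B hB =>
    hC.subset_of_subset hF hA (hD.subset hB) (hDC B hB)
  have habsD : ∀ B ∈ D, ∀ A ∈ C, B ⊆ A → ∀ B' ∈ D, B' ⊆ A := fun B hB A hA =>
    hD.subset_of_subset hF hB (hC.subset hA) (hCD A hA)
  have hnest : ∀ A ∈ C, ∀ B ∈ D, Disjoint A B ∨ A ⊆ B ∨ B ⊆ A := fun A hA B hB =>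
    nested_of_not_crosses (hF A (hC.subset hA)) (hF B (hD.subset hB))
      fun h => hDC B hB (hC.mem_of_crosses hA (hD.subset hB) h)
  obtain ⟨A, hA, hsA⟩ := hsC
  obtain ⟨B, hB, hsB⟩ := hsD
  -- If A and B are disjoint, then some B' ∈ D absorbs A, hence all of C, and some A' ∈ C absorbs B,
  -- hence all of D. So A' = B' lies in both components.
  have key : ∀ y z, y ∈ A → z ∈ B → Disjoint A B → (∃ S ∈ D, y ∈ S) → (∃ S ∈ C, z ∈ S) → False := by
    rintro y z hy hz hAB ⟨B', hB', hyB'⟩ ⟨A', hA', hzA'⟩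
    have h1 : B ⊆ A' := by
      rcases hnest A' hA' B hB with h | h | h
      · exact absurd hz (Finset.disjoint_left.1 h hzA')
      · exact absurd (habsC A' hA' B hB h A hA hy) (Finset.disjoint_left.1 hAB hy)
      · exact h
    have h2 : A ⊆ B' := by
      rcases hnest A hA B' hB' with h | h | h
      · exact absurd hyB' (Finset.disjoint_left.1 h hy)
      · exact h
      · exact absurd hz (Finset.disjoint_left.1 hAB (habsD B' hB' A hA h B hB hz))
    have h3 := habsC A hA B' hB' h2 A' hA'
    have h4 := habsD B hB A' hA' h1 B' hB'
    exact hCD A' hA' (h3.antisymm h4 ▸ hB')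
  obtain ⟨Su, hSu, huSu⟩ := huC
  obtain ⟨Sv, hSv, hvSv⟩ := hvC
  obtain ⟨Tu, hTu, huTu⟩ := huD
  obtain ⟨Tv, hTv, hvTv⟩ := hvD
  rcases hnest A hA B hB with h | h | h
  · have hd : ∀ y, y ∈ A → y ∉ B := fun y => (Finset.disjoint_left.1 h ·)
    by_cases hu : u ∈ A
    · have hv : v ∈ B := by
        have := hd u hu
        tauto
      exact key u v hu hv h ⟨Tu, hTu, huTu⟩ ⟨Sv, hSv, hvSv⟩
    · have hv : v ∈ A := by tauto
      have hu' : u ∈ B := by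
        have := hd v hv
        tauto
      exact key v u hv hu' h ⟨Tv, hTv, hvTv⟩ ⟨Su, hSu, huSu⟩
  · have := habsC A hA B hB h
    exact hsB (iff_of_true (this Su hSu huSu) (this Sv hSv hvSv))
  · have := habsD B hB A hA h
    exact hsA (iff_of_true (this Tu hTu huTu) (this Tv hTv hvTv))

/-! ### The two laminar families of a component -/

open scoped Classical in
/-- The vertices covered by a family of cuts. -/
noncomputable def support (C : Set (Finset V)) : Finset V :=
  Finset.univ.filter fun v => ∃ S ∈ C, v ∈ S

theorem mem_support {C : Set (Finset V)} {v : V} : v ∈ support C ↔ ∃ S ∈ C, v ∈ S := by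
  simp [support]

/-- `H` and `C ∖ H` are families of pairwise noncrossing cuts. -/
def Splits (C H : Set (Finset V)) : Prop :=
  H ⊆ C ∧ (∀ A ∈ H, ∀ B ∈ H, ¬ Crosses A B) ∧ ∀ A ∈ C, ∀ B ∈ C, A ∉ H → B ∉ H → ¬ Crosses A B

open scoped Classical in
/-- One of the two parts of a splitting of `C`. -/
noncomputable def half (C : Set (Finset V)) : Set (Finset V) :=
  -- The choice depends on C alone, because the vector has to be fixed before any polygon
  -- representation is given.
  if h : ∃ H, Splits C H then h.choose else ∅

theorem splits_half {C : Set (Finset V)} (h : ∃ H, Splits C H) : Splits C (half C) := by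
  rw [half, dif_pos h]
  exact h.choose_spec

/-- The two laminar families of `C`; the atoms are added to the first one. -/
def laminarPart (C : Set (Finset V)) (j : Bool) : Set (Finset V) :=
  if j then half C ∪ {a | IsAtom C a ∧ a ⊆ support C} else C \ half C

theorem mem_laminarPart {C : Set (Finset V)} (h : ∃ H, Splits C H) {j : Bool} {S : Finset V}
    (hS : S ∈ laminarPart C j) : S ∈ C ∨ (IsAtom C S ∧ S ⊆ support C) := by
  cases j
  · exact Or.inl hS.1
  · exact hS.imp (fun h' => (splits_half h).1 h') id

theorem exists_mem_laminarPart {C : Set (Finset V)} {S : Finset V}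
    (hS : S ∈ C ∨ (IsAtom C S ∧ S ⊆ support C)) : ∃ j, S ∈ laminarPart C j := by
  by_cases h : S ∈ half C ∪ {a | IsAtom C a ∧ a ⊆ support C}
  · exact ⟨true, h⟩
  · exact ⟨false, hS.resolve_right fun h' => h (Or.inr h'), fun h' => h (Or.inl h')⟩

theorem IsAtom.nested {C : Set (Finset V)} {a S : Finset V} (ha : IsAtom C a)
    (hS : S ∈ C ∨ (IsAtom C S ∧ S ⊆ support C)) : Disjoint a S ∨ a ⊆ S := by
  by_cases hd : Disjoint a S
  · exact Or.inl hd
  obtain ⟨v, hva, hvS⟩ := Finset.not_disjoint_iff.1 hd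
  right
  rcases hS with hS | hS
  · exact ha.subset_of_mem hS hva hvS
  · exact (ha.eq_of_mem hS.1 hva hvS).subset

theorem laminarPart_nested {C : Set (Finset V)} (h : ∃ H, Splits C H) {u₀ : V}
    (hu : ∀ S ∈ C, u₀ ∉ S) {j : Bool} {A B : Finset V} (hA : A ∈ laminarPart C j)
    (hB : B ∈ laminarPart C j) : Disjoint A B ∨ A ⊆ B ∨ B ⊆ A := by
  rcases mem_laminarPart h hA with hAC | hAa
  · rcases mem_laminarPart h hB with hBC | hBa
    -- A cut of C that is an atom may be in the first family without belonging to `half C`.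
    · by_cases hat : IsAtom C A ∨ IsAtom C B
      · rcases hat with hat | hat
        · exact (hat.nested (Or.inl hBC)).imp id Or.inl
        · exact (hat.nested (Or.inl hAC)).imp (fun h => h.symm) Or.inr
      · refine nested_of_not_crosses (hu A hAC) (hu B hBC) ?_
        obtain ⟨-, h1, h2⟩ := splits_half h
        cases j
        · exact h2 A hAC B hBC hA.2 hB.2
        · exact h1 A (hA.resolve_right fun h => hat (Or.inl h.1)) B
            (hB.resolve_right fun h => hat (Or.inr h.1))
    · exact (hBa.1.nested (Or.inl hAC)).imp (fun h => h.symm) Or.inr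
  · exact (hAa.1.nested (mem_laminarPart h hB)).imp id Or.inl

/-! ### The edges charged by a cut -/

/-- The triple `(C, j, S)` charges the edges between `S` and the rest of the smallest larger set
of the laminar family number `j` of the component `C`. -/
def Charges (F : Set (Finset V)) (i : Set (Finset V) × Bool × Finset V) (e : Sym2 V) : Prop :=
  IsComponent F i.1 ∧ (∃ H, Splits i.1 H) ∧ i.2.2 ∈ laminarPart i.1 i.2.1 ∧
    ∃ u ∈ i.2.2, ∃ v ∈ support i.1 \ i.2.2, e = s(u, v) ∧
      -- Asking for membership in every larger set makes the support of C the default when there is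
      -- none.
      ∀ S ∈ laminarPart i.1 i.2.1, i.2.2 ⊂ S → v ∈ S

theorem subset_support {C : Set (Finset V)} {S : Finset V}
    (hS : S ∈ C ∨ (IsAtom C S ∧ S ⊆ support C)) : S ⊆ support C :=
  hS.elim (fun h _ hv => mem_support.2 ⟨S, h, hv⟩) And.right

theorem exists_separates {C : Set (Finset V)} {S : Finset V}
    (hS : S ∈ C ∨ (IsAtom C S ∧ S ⊆ support C)) {u v : V} (hu : u ∈ S) (hv : v ∉ S) :
    ∃ A ∈ C, ¬ (u ∈ A ↔ v ∈ A) := by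
  rcases hS with hS | hS
  · exact ⟨S, hS, fun h => hv (h.1 hu)⟩
  · by_contra! h
    refine hv ?_
    rw [hS.1.eq_atomOf hu]
    exact mem_atomOf.2 h

open scoped Classical in
/-- Every edge is charged at most four times. -/
theorem card_charges_le {F : Set (Finset V)} {u₀ : V} (hF : ∀ S ∈ F, u₀ ∉ S) (e : Sym2 V) :
    (Finset.univ.filter fun i => Charges F i e).card ≤ 4 := by
  induction e using Sym2.ind with
  | _ a b =>
  have hcard : (Finset.univ : Finset (Bool × Bool)).card = 4 := rfl
  rw [← hcard]
  -- The key is the family and whether a is the endpoint inside S. With equal keys, both sets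
  -- contain the same endpoint and avoid the other; they are nested, and the larger one would have
  -- to contain both.
  refine Finset.card_le_card_of_injOn (fun i => (i.2.1, decide (a ∈ i.2.2)))
    (fun _ _ => Finset.mem_univ _) ?_
  rintro ⟨C, j, S⟩ hi ⟨D, k, S'⟩ hi' hij
  simp only [Finset.coe_filter, Finset.mem_univ, true_and, Set.mem_ofPred_eq] at hi hi'
  obtain ⟨hC, hH, hS, u, hu, v, hv, he, hmin⟩ := hi
  obtain ⟨hD, hH', hS', u', hu', v', hv', he', hmin'⟩ := hi'
  simp only [Prod.mk.injEq, decide_eq_decide] at hij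
  obtain ⟨rfl, hij⟩ := hij
  dsimp only at hC hH hS hu hv hmin hD hH' hS' hu' hv' hmin'
  rw [Finset.mem_sdiff] at hv hv'
  have huv : u = u' ∧ v = v' := by
    rcases Sym2.eq_iff.1 he with ⟨rfl, rfl⟩ | ⟨rfl, rfl⟩ <;>
      rcases Sym2.eq_iff.1 he' with ⟨rfl, rfl⟩ | ⟨rfl, rfl⟩ <;> tauto
  obtain ⟨rfl, rfl⟩ := huv
  have mS := mem_laminarPart hH hS
  have mS' := mem_laminarPart hH' hS'
  obtain rfl : C = D := hC.eq_of_separates hD hF (mem_support.1 (subset_support mS hu))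
    (mem_support.1 hv.1) (mem_support.1 (subset_support mS' hu')) (mem_support.1 hv'.1)
    (exists_separates mS hu hv.2) (exists_separates mS' hu' hv'.2)
  have hSS' : S = S' := by
    rcases laminarPart_nested hH (fun A hA => hF A (hC.subset hA)) hS hS' with h | h | h
    · exact absurd hu' (Finset.disjoint_left.1 h hu)
    · exact h.eq_of_not_ssubset fun h => hv'.2 (hmin _ hS' h)
    · exact (h.eq_of_not_ssubset fun h => hv.2 (hmin' _ hS h)).symm
  rw [hSS']

/-- The edges charged by `S` contain all edges between `S` and the rest of some near minimum
cut. -/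
theorem exists_charged {F C : Set (Finset V)} {g : Sym2 V → ℝ} {u₀ v₀ : V} {η : ℝ} (hη : 0 < η)
    (hg : IsCutSystem g u₀ v₀) (hC : IsComponent F C) (hfam : IsOneSidedFamily g u₀ v₀ η C)
    (hH : ∃ H, Splits C H) (hU : cutWeight g (support C) ≤ 2 + 2 * η) {j : Bool} {S : Finset V}
    (hS : S ∈ laminarPart C j) (hne : S.Nonempty) (hSU : S ≠ support C) :
    ∃ Y, 1 - η ≤ pairWeight g S (Y \ S) ∧
      ∀ u ∈ S, ∀ v ∈ Y \ S, Charges F (C, j, S) s(u, v) := by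
  have mS := mem_laminarPart hH hS
  have hu0 : u₀ ∉ support C := fun h => by
    obtain ⟨A, hA, h⟩ := mem_support.1 h
    exact (hfam.avoid A hA).1 h
  have hv0 : v₀ ∉ support C := fun h => by
    obtain ⟨A, hA, h⟩ := mem_support.1 h
    exact (hfam.avoid A hA).2 h
  -- Twice the weight between S and Y ∖ S is x(δ(S)) + x(δ(Y ∖ S)) - x(δ(Y)) ≥ 4 - (2 + 2η).
  have hw : ∀ Y, S ⊂ Y → Y ⊆ support C → cutWeight g Y ≤ 2 + 2 * η →
      1 - η ≤ pairWeight g S (Y \ S) := by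
    intro Y hSY hYU hY
    have h1 := cutWeight_union g (X := S) (Y := Y \ S) Finset.disjoint_sdiff
    rw [Finset.union_sdiff_of_subset hSY.subset] at h1
    have h2 := hg.two_le S hne (fun h => hu0 (subset_support mS h))
      fun h => hv0 (subset_support mS h)
    have h3 := hg.two_le (Y \ S) (Finset.sdiff_nonempty.2 hSY.2)
      (fun h => hu0 (hYU (Finset.sdiff_subset h))) fun h => hv0 (hYU (Finset.sdiff_subset h))
    linarith
  by_cases hsup : ∃ A, A ∈ laminarPart C j ∧ S ⊂ A
  · obtain ⟨Y, ⟨hY, hSY⟩, hmin⟩ := (Set.toFinite {A | A ∈ laminarPart C j ∧ S ⊂ A}).exists_minimal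
      hsup
    have hYC : Y ∈ C := by
      refine (mem_laminarPart hH hY).resolve_right fun hYa => ?_
      rcases hYa.1.nested mS with h | h
      · obtain ⟨v, hv⟩ := hne
        exact Finset.disjoint_left.1 h (hSY.subset hv) hv
      · exact hSY.2 h
    have mY := subset_support (Or.inl hYC : Y ∈ C ∨ _)
    refine ⟨Y, hw Y hSY mY (by linarith [hfam.near Y hYC]), fun u hu v hv =>
      ⟨hC, hH, hS, u, hu, v, Finset.sdiff_subset_sdiff mY subset_rfl hv, rfl, fun A hA hSA => ?_⟩⟩
    have hvY := (Finset.mem_sdiff.1 hv).1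
    rcases laminarPart_nested hH (fun A hA => (hfam.avoid A hA).1) hY hA with h | h | h
    · exact absurd (hSA.subset hu) (Finset.disjoint_left.1 h (hSY.subset hu))
    · exact h hvY
    · exact hmin ⟨hA, hSA⟩ h hvY
  · refine ⟨support C, hw _ ((subset_support mS).ssubset_of_ne hSU) subset_rfl hU,
      fun u hu v hv => ⟨hC, hH, hS, u, hu, v, hv, rfl, fun A hA hSA => absurd ⟨A, hA, hSA⟩ hsup⟩⟩

/-! ### Relevant cuts of a polygon -/

namespace PolygonRep

variable {g : Sym2 V → ℝ} {u₀ v₀ : V} {η : ℝ} {C : Set (Finset V)}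

/-- H consists of the cuts that overlap another one to their right. If two of them crossed, the
right one would be overlapped from both sides; and of any two crossing cuts the left one is in H. -/
theorem exists_splits (P : PolygonRep C) (hg : IsCutSystem g u₀ v₀)
    (hC : IsOneSidedFamily g u₀ v₀ η C) (hroot : u₀ ∈ P.outer 0) {ι : V → ZMod P.m}
    (hι : ∀ v k, v ∈ P.outer k ↔ ι v = k) : ∃ H, Splits C H := by
  have hsys := (P.isIntervalModel hg hC hroot hι).sys
  have hov : ∀ A ∈ C, ∀ B ∈ C, Crosses A B → _ := fun A hA B hB =>
    P.overlaps_of_crosses hι hroot hA hB (hC.avoid A hA).1 (hC.avoid B hB).1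
  refine ⟨{A | A ∈ C ∧ ∃ B ∈ C, Overlaps (P.lo A, P.hi A) (P.lo B, P.hi B)}, fun A hA => hA.1,
    ?_, ?_⟩
  · rintro A ⟨hA, A', hA', hAA'⟩ B ⟨hB, B', hB', hBB'⟩ h
    rcases hov A hA B hB h with h | h
    · exact hsys.one_side _ ⟨A, hA, rfl⟩ _ ⟨B, hB, rfl⟩ _ ⟨B', hB', rfl⟩ h hBB'
    · exact hsys.one_side _ ⟨B, hB, rfl⟩ _ ⟨A, hA, rfl⟩ _ ⟨A', hA', rfl⟩ h hAA'
  · intro A hA B hB hA' hB' h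
    rcases hov A hA B hB h with h | h
    · exact hA' ⟨hA, B, hB, h⟩
    · exact hB' ⟨hB, A, hA, h⟩

theorem outer_zero_eq (P : PolygonRep C) (hu : ∀ S ∈ C, u₀ ∉ S) (hroot : u₀ ∈ P.outer 0) :
    P.outer 0 = (support C)ᶜ := by
  ext v
  rw [(P.outer_atom 0).eq_atomOf hroot, mem_atomOf, Finset.mem_compl, mem_support]
  push Not
  exact forall₂_congr fun S hS => by simp [hu S hS]

theorem support_eq_block (P : PolygonRep C) (hu : ∀ S ∈ C, u₀ ∉ S) (hroot : u₀ ∈ P.outer 0)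
    {ι : V → ZMod P.m} (hι : ∀ v k, v ∈ P.outer k ↔ ι v = k) :
    support C = block (fun v => (ι v).val) 1 (P.m - 1) := by
  ext v
  have h1 : v ∈ support C ↔ ι v ≠ 0 := by
    rw [Ne, ← hι, P.outer_zero_eq hu hroot, Finset.mem_compl, not_not]
  have h2 := ZMod.val_lt (ι v)
  have h3 : (ι v).val = 0 ↔ ι v = 0 := ZMod.val_eq_zero _
  rw [h1, mem_block, Ne, ← h3]
  omega

theorem neg_one_val (P : PolygonRep C) : (-1 : ZMod P.m).val = P.m - 1 := by
  have h := zmod_val_sub (0 : ZMod P.m) 1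
  rw [zero_sub, P.one_val, ZMod.val_zero] at h
  omega

theorem outer_eq_block (P : PolygonRep C) {ι : V → ZMod P.m}
    (hι : ∀ v k, v ∈ P.outer k ↔ ι v = k) (k : ZMod P.m) :
    P.outer k = block (fun v => (ι v).val) k.val k.val := by
  ext v
  rw [hι, mem_block, ← (ZMod.val_injective P.m).eq_iff]
  omega

/-- A relevant cut has two arms, or it is a leftmost or rightmost cut or atom whose complement in
the polygon is a near minimum cut. -/
theorem IsRelevant.arms_or_boundary {P : PolygonRep C} {E : Finset (Sym2 V)} {x : Sym2 V → ℝ}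
    (hg : IsCutSystem (restrictTo E x) u₀ v₀) (hη : 0 < η)
    (hC : IsOneSidedFamily (restrictTo E x) u₀ v₀ η C) (hroot : u₀ ∈ P.outer 0)
    {ι : V → ZMod P.m} (hι : ∀ v k, v ∈ P.outer k ↔ ι v = k) {S : Finset V}
    (hS : P.IsRelevant E x η S) :
    HasTwoArms (restrictTo E x) u₀ v₀ η S ∨
      (cutWeight (restrictTo E x) (support C \ S) ≤ 2 + 2 * η ∧
        (P.IsLeftmostCutOrAtom S ∨ P.IsRightmostCutOrAtom S)) := by
  have hmod := P.isIntervalModel hg hC hroot hι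
  have hm := P.three_le
  have hsub : ∀ S ∈ C, ∀ k : ZMod P.m, P.outer k ⊆ S ↔ P.lo S ≤ k.val ∧ k.val ≤ P.hi S := by
    intro S hS k
    obtain ⟨v, hv⟩ := (P.outer_atom k).nonempty
    have h1 : P.outer k ⊆ S ↔ v ∈ S := ⟨fun h => h hv, P.outer_subset_of_mem hS hv⟩
    rw [h1, (P.eq_block hι hroot hS (hC.avoid S hS).1).1, mem_block, (hι v k).1 hv,
      ← (P.eq_block hι hroot hS (hC.avoid S hS).1).1]
  rw [P.support_eq_block (fun S hS => (hC.avoid S hS).1) hroot hι]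
  rcases hS with hS | ⟨i, hi0, rfl, -⟩
  · obtain ⟨hb, h1, h2, h3⟩ := P.eq_block hι hroot hS (hC.avoid S hS).1
    have h := hmod.arms_or_boundary hη ⟨S, hS, rfl⟩
    dsimp only at h
    rw [← hb] at h
    refine h.imp id fun h => ⟨h.1, ?_⟩
    have e0 : (0 : ZMod P.m).val = 0 := ZMod.val_zero
    rcases h.2 with h | h
    · refine Or.inl (Or.inl ⟨hS, (hsub S hS _).2 ?_, fun h' => ?_⟩)
      · rw [P.one_val]
        omega
      · rw [sub_self, hsub S hS] at h'
        omega
    · refine Or.inr (Or.inl ⟨hS, (hsub S hS _).2 ?_, fun h' => ?_⟩)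
      · rw [P.neg_one_val]
        omega
      · rw [neg_add_cancel, hsub S hS] at h'
        omega
  · have hi1 : i.val ≠ 0 := by rwa [Ne, ZMod.val_eq_zero]
    have hi2 := ZMod.val_lt i
    have e := P.outer_eq_block hι i
    by_cases h1 : i.val = 1
    · right
      obtain rfl : i = 1 := ZMod.val_injective _ (h1.trans P.one_val.symm)
      refine ⟨?_, Or.inl (Or.inr rfl)⟩
      rw [e, P.one_val]
      exact hmod.cutWeight_univ_sdiff_first_le hη
    by_cases h2 : i.val = P.m - 1
    · right
      obtain rfl : i = -1 := ZMod.val_injective _ (h2.trans P.neg_one_val.symm)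
      refine ⟨?_, Or.inr (Or.inr rfl)⟩
      rw [e, P.neg_one_val]
      exact hmod.cutWeight_univ_sdiff_last_le hη
    · left
      rw [e]
      exact hmod.hasTwoArms_singleton hη (by omega) (by omega)

theorem IsRelevant.mem_or_isAtom {P : PolygonRep C} {E : Finset (Sym2 V)} {x : Sym2 V → ℝ}
    (hu : ∀ S ∈ C, u₀ ∉ S) (hroot : u₀ ∈ P.outer 0) {S : Finset V}
    (hS : P.IsRelevant E x η S) : S ∈ C ∨ (IsAtom C S ∧ S ⊆ support C) := by
  refine hS.imp id ?_
  rintro ⟨i, hi, rfl, -⟩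
  refine ⟨P.outer_atom i, fun v hv => ?_⟩
  by_contra h
  rw [← Finset.mem_compl, ← P.outer_zero_eq hu hroot] at h
  exact hi (P.outer_injective ((P.outer_atom i).eq_of_mem (P.outer_atom 0) hv h))

/-- No cut of the family contains both the leftmost and the rightmost atom. -/
theorem not_both_ends (P : PolygonRep C) (hC : IsOneSidedFamily g u₀ v₀ η C)
    (hroot : u₀ ∈ P.outer 0) {ι : V → ZMod P.m} (hι : ∀ v k, v ∈ P.outer k ↔ ι v = k)
    {S : Finset V} (hS : S ∈ C) (h1 : P.outer 1 ⊆ S) (h2 : P.outer (-1) ⊆ S) : False := by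
  -- An interval with both ends is all of {1, …, m-1}, so the cut that crosses S has no vertex
  -- outside of S.
  obtain ⟨B, hB, hSB⟩ := hC.exists_crosses hS
  obtain ⟨v, hv⟩ := hSB.2.2.1
  obtain ⟨hvB, hvS⟩ := Finset.mem_sdiff.1 hv
  obtain ⟨hb, -, -, -⟩ := P.eq_block hι hroot hS (hC.avoid S hS).1
  obtain ⟨y, hy⟩ := (P.outer_atom 1).nonempty
  obtain ⟨z, hz⟩ := (P.outer_atom (-1)).nonempty
  have hyS := h1 hy
  have hzS := h2 hz
  have hvU : v ∈ support C := mem_support.2 ⟨B, hB, hvB⟩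
  rw [P.support_eq_block (fun S hS => (hC.avoid S hS).1) hroot hι, mem_block] at hvU
  rw [hb, mem_block] at hyS hzS hvS
  rw [(hι _ _).1 hy, P.one_val] at hyS
  rw [(hι _ _).1 hz, P.neg_one_val] at hzS
  omega

theorem one_ne_neg_one (P : PolygonRep C) : (1 : ZMod P.m) ≠ -1 := by
  intro h
  have h1 := congrArg ZMod.val h
  rw [P.one_val, P.neg_one_val] at h1
  have := P.three_le
  omega

theorem IsLeftmostCutOrAtom.ends {P : PolygonRep C} (hC : IsOneSidedFamily g u₀ v₀ η C)
    (hroot : u₀ ∈ P.outer 0) {ι : V → ZMod P.m} (hι : ∀ v k, v ∈ P.outer k ↔ ι v = k)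
    {S : Finset V} (hS : P.IsLeftmostCutOrAtom S) :
    P.outer 1 ⊆ S ∧ Disjoint (P.outer (-1)) S := by
  rcases hS with ⟨hS, h1, -⟩ | rfl
  · refine ⟨h1, Finset.disjoint_left.2 fun v hv hvS => ?_⟩
    exact P.not_both_ends hC hroot hι hS h1 (P.outer_subset_of_mem hS hv hvS)
  · refine ⟨subset_rfl, Finset.disjoint_left.2 fun v hv hvS => ?_⟩
    exact P.one_ne_neg_one (((hι _ _).1 hvS).symm.trans ((hι _ _).1 hv))

theorem IsRightmostCutOrAtom.ends {P : PolygonRep C} (hC : IsOneSidedFamily g u₀ v₀ η C)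
    (hroot : u₀ ∈ P.outer 0) {ι : V → ZMod P.m} (hι : ∀ v k, v ∈ P.outer k ↔ ι v = k)
    {S : Finset V} (hS : P.IsRightmostCutOrAtom S) :
    P.outer (-1) ⊆ S ∧ Disjoint (P.outer 1) S := by
  rcases hS with ⟨hS, h1, -⟩ | rfl
  · refine ⟨h1, Finset.disjoint_left.2 fun v hv hvS => ?_⟩
    exact P.not_both_ends hC hroot hι hS (P.outer_subset_of_mem hS hv hvS) h1
  · refine ⟨subset_rfl, Finset.disjoint_left.2 fun v hv hvS => ?_⟩
    exact P.one_ne_neg_one (((hι _ _).1 hv).symm.trans ((hι _ _).1 hvS))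

end PolygonRep

/-! ### Parity of a cut in a happy polygon -/

/-- If all edges of `T` in `δ(r)` lie in `E(a, r)` or `E(b, r)`, and `S` contains `a` and avoids `b`
and `r`, then the edges of `T` between `S` and `r` are those between `a` and `r`. -/
theorem edgesBetween_inter_eq {E T : Finset (Sym2 V)} {a b r S : Finset V} (haS : a ⊆ S)
    (hbS : Disjoint b S) (hrS : Disjoint r S)
    (h : ∀ e ∈ T, e ∈ delta E r → e ∈ edgesBetween E a r ∨ e ∈ edgesBetween E b r) :
    edgesBetween E S r ∩ T = edgesBetween E a r ∩ T := by
  ext e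
  simp only [Finset.mem_inter]
  refine and_congr_left fun heT => ⟨fun he => ?_, fun he => ?_⟩
  · obtain ⟨heE, u, hu, v, hv, rfl⟩ := mem_edgesBetween.1 he
    refine (h _ heT ?_).resolve_right fun hb => ?_
    · exact mem_edgesBetween.2 ⟨heE, v, hv, u,
        Finset.mem_compl.2 fun h => Finset.disjoint_left.1 hrS h hu, Sym2.eq_swap⟩
    · obtain ⟨-, y, hy, z, hz, hyz⟩ := mem_edgesBetween.1 hb
      rcases Sym2.eq_iff.1 hyz with ⟨rfl, rfl⟩ | ⟨rfl, rfl⟩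
      · exact Finset.disjoint_left.1 hbS hy hu
      · exact Finset.disjoint_left.1 hrS hz hu
  · obtain ⟨heE, u, hu, v, hv, rfl⟩ := mem_edgesBetween.1 he
    exact mem_edgesBetween.2 ⟨heE, u, haS hu, v, hv, rfl⟩

theorem card_delta_inter_eq_add {E T : Finset (Sym2 V)} (hT : T ⊆ E) {S U : Finset V}
    (hSU : S ⊆ U) : (delta E S ∩ T).card =
      (edgesBetween E S (U \ S) ∩ T).card + (edgesBetween E S Uᶜ ∩ T).card := by
  have h1 : Disjoint S Uᶜ := Finset.disjoint_left.2 fun v h h' => Finset.mem_compl.1 h' (hSU h)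
  have h2 : Disjoint (U \ S) Uᶜ := Finset.disjoint_left.2 fun v h h' =>
    Finset.mem_compl.1 h' (Finset.mem_sdiff.1 h).1
  have h3 : Sᶜ = U \ S ∪ Uᶜ := by
    ext v
    have := @hSU v
    simp only [Finset.mem_compl, Finset.mem_union, Finset.mem_sdiff]
    tauto
  have : ((delta E S ∩ T).card : ℝ) =
      ((edgesBetween E S (U \ S) ∩ T).card : ℝ) + ((edgesBetween E S Uᶜ ∩ T).card : ℝ) := by
    rw [card_delta_inter hT, card_edgesBetween_inter hT Finset.disjoint_sdiff,
      card_edgesBetween_inter hT h1, cutWeight, h3, pairWeight_union_right _ _ h2]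
  exact_mod_cast this

/-! ### The random vector -/

open scoped Classical in
/-- The event in which the triple `(C, j, S)` raises the edges that it charges. -/
def Raises (E : Finset (Sym2 V)) (μ : Finset (Sym2 V) → ℝ) (η : ℝ)
    (i : Set (Finset V) × Bool × Finset V) (T : Finset (Sym2 V)) : Prop :=
  -- The case is decided by the probabilities, not by the place of S in a polygon, so the event is
  -- rare by construction. The threshold is a quarter of 44η; the bounds 7η and 5η/2 lie below it.
  if treeProb μ (fun T => Odd (delta E i.2.2 ∩ T).card) ≤ 11 * η then
    Odd (delta E i.2.2 ∩ T).card
  else treeProb μ (fun T => Even (edgesBetween E i.2.2 (support i.1 \ i.2.2) ∩ T).card) ≤ 11 * η ∧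
    Even (edgesBetween E i.2.2 (support i.1 \ i.2.2) ∩ T).card

theorem treeProb_raises_le (E : Finset (Sym2 V)) (μ : Finset (Sym2 V) → ℝ) {η : ℝ} (hη : 0 < η)
    (i : Set (Finset V) × Bool × Finset V) : treeProb μ (Raises E μ η i) ≤ 11 * η := by
  by_cases h1 : treeProb μ (fun T => Odd (delta E i.2.2 ∩ T).card) ≤ 11 * η
  · have : Raises E μ η i = fun T => Odd (delta E i.2.2 ∩ T).card := by
      ext T
      rw [Raises, if_pos h1]
    rwa [this]
  by_cases h2 : treeProb μ
      (fun T => Even (edgesBetween E i.2.2 (support i.1 \ i.2.2) ∩ T).card) ≤ 11 * η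
  · have : Raises E μ η i =
        fun T => Even (edgesBetween E i.2.2 (support i.1 \ i.2.2) ∩ T).card := by
      ext T
      rw [Raises, if_neg h1, and_iff_right h2]
    rwa [this]
  · have : Raises E μ η i = fun _ => False := by
      ext T
      rw [Raises, if_neg h1]
      exact iff_of_false (fun h => h2 h.1) id
    rw [this]
    simp [treeProb, hη.le]

open scoped Classical in
/-- The vector `s*`. -/
noncomputable def raisedVector (F : Set (Finset V)) (E : Finset (Sym2 V)) (x : Sym2 V → ℝ)
    (μ : Finset (Sym2 V) → ℝ) (α η : ℝ) (T : Finset (Sym2 V)) (e : Sym2 V) : ℝ :=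
  α * restrictTo E x e *
    ∑ i ∈ Finset.univ.filter (fun i => Charges F i e), if Raises E μ η i T then 1 else 0

theorem raisedVector_nonneg {F : Set (Finset V)} {E : Finset (Sym2 V)} {x : Sym2 V → ℝ}
    {μ : Finset (Sym2 V) → ℝ} {α η : ℝ} (hα : 0 < α) (hx : ∀ e, 0 ≤ restrictTo E x e)
    (T : Finset (Sym2 V)) (e : Sym2 V) : 0 ≤ raisedVector F E x μ α η T e :=
  mul_nonneg (mul_nonneg hα.le (hx e)) (Finset.sum_nonneg fun i _ => by split_ifs <;> norm_num)

theorem expect_raisedVector_le {F : Set (Finset V)} {E : Finset (Sym2 V)} {x : Sym2 V → ℝ}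
    {μ : Finset (Sym2 V) → ℝ} {α η : ℝ} (hα : 0 < α) (hη : 0 < η)
    (hx : ∀ e, 0 ≤ restrictTo E x e) {u₀ : V} (hF : ∀ S ∈ F, u₀ ∉ S) (e : Sym2 V) :
    ∑ T, μ T * raisedVector F E x μ α η T e ≤ 44 * α * η * restrictTo E x e := by
  classical
  have h1 : ∑ T, μ T * raisedVector F E x μ α η T e = α * restrictTo E x e *
      ∑ i ∈ Finset.univ.filter (fun i => Charges F i e), treeProb μ (Raises E μ η i) := by
    simp only [raisedVector, treeProb]
    rw [Finset.sum_comm, Finset.mul_sum]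
    refine Finset.sum_congr rfl fun T _ => ?_
    rw [mul_left_comm, Finset.mul_sum]
    congr 1
    exact Finset.sum_congr rfl fun i _ => by rw [mul_ite, mul_one, mul_zero]
  have h2 : ∑ i ∈ Finset.univ.filter (fun i => Charges F i e), treeProb μ (Raises E μ η i) ≤
      4 * (11 * η) := by
    refine (Finset.sum_le_card_nsmul _ _ (11 * η) fun i _ => treeProb_raises_le E μ hη i).trans ?_
    rw [nsmul_eq_mul]
    refine mul_le_mul_of_nonneg_right ?_ (by positivity)
    exact_mod_cast card_charges_le hF e
  rw [h1]
  have := mul_le_mul_of_nonneg_left h2 (mul_nonneg hα.le (hx e))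
  linarith

/-- If a relevant cut raises the edges that it charges, then the vector is large on it. -/
theorem le_sum_raisedVector {F : Set (Finset V)} {E : Finset (Sym2 V)} {x : Sym2 V → ℝ}
    {μ : Finset (Sym2 V) → ℝ} {α η : ℝ} (hα : 0 < α) (hx : ∀ e, 0 ≤ restrictTo E x e)
    {i : Set (Finset V) × Bool × Finset V} {T : Finset (Sym2 V)} (hi : Raises E μ η i T)
    {Y : Finset V} (hY : 1 - η ≤ pairWeight (restrictTo E x) i.2.2 (Y \ i.2.2))
    (hch : ∀ u ∈ i.2.2, ∀ v ∈ Y \ i.2.2, Charges F i s(u, v)) :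
    α * (1 - η) ≤ ∑ e ∈ delta E i.2.2, raisedVector F E x μ α η T e := by
  classical
  have hsub : edgesBetween E i.2.2 (Y \ i.2.2) ⊆ delta E i.2.2 := by
    intro e he
    obtain ⟨heE, u, hu, v, hv, rfl⟩ := mem_edgesBetween.1 he
    exact mem_edgesBetween.2 ⟨heE, u, hu, v, Finset.mem_compl.2 (Finset.mem_sdiff.1 hv).2, rfl⟩
  calc α * (1 - η) ≤ α * pairWeight (restrictTo E x) i.2.2 (Y \ i.2.2) :=
        mul_le_mul_of_nonneg_left hY hα.le
    _ = ∑ e ∈ edgesBetween E i.2.2 (Y \ i.2.2), α * x e := by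
        rw [← sum_edgesBetween E x Finset.disjoint_sdiff, Finset.mul_sum]
    _ ≤ ∑ e ∈ edgesBetween E i.2.2 (Y \ i.2.2), raisedVector F E x μ α η T e := by
        refine Finset.sum_le_sum fun e he => ?_
        obtain ⟨heE, u, hu, v, hv, rfl⟩ := mem_edgesBetween.1 he
        have hxe : restrictTo E x s(u, v) = x s(u, v) := by rw [restrictTo, if_pos heE]
        have hx0 : 0 ≤ x s(u, v) := hxe ▸ hx s(u, v)
        rw [raisedVector, hxe]
        refine le_mul_of_one_le_right (mul_nonneg hα.le hx0) ?_
        have h1 := Finset.single_le_sum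
          (f := fun i => if Raises E μ η i T then (1 : ℝ) else 0)
          (s := Finset.univ.filter fun i => Charges F i s(u, v))
          (fun j _ => by split_ifs <;> norm_num)
          (Finset.mem_filter.2 ⟨Finset.mem_univ i, hch u hu v hv⟩)
        simpa only [if_pos hi] using h1
    _ ≤ ∑ e ∈ delta E i.2.2, raisedVector F E x μ α η T e :=
        Finset.sum_le_sum_of_subset_of_nonneg hsub fun e _ _ => raisedVector_nonneg hα hx T e

end NearMinCut

open NearMinCut

theorem mainTheorem5 {V : Type*} [Fintype V] [DecidableEq V]
    (x : Sym2 V → ℝ) (hx : NearMinCut.IsSubtourSolution x)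
    (u₀ v₀ : V) (huv : u₀ ≠ v₀) (he₀ : x s(u₀, v₀) = 1)
    (E : Finset (Sym2 V)) (hE : E = NearMinCut.supportEdges x u₀ v₀)
    (μ : Finset (Sym2 V) → ℝ) (hμ : NearMinCut.IsTreeDistribution E x μ)
    (α η : ℝ) (hα : 0 < α) (hη : 0 < η) (hη' : η ≤ 1 / 10) :
    ∃ s : Finset (Sym2 V) → Sym2 V → ℝ,
      (∀ T e, 0 ≤ s T e) ∧
      (∀ C : Set (Finset V),
        NearMinCut.IsComponent (NearMinCut.oneSidedCuts E x u₀ v₀ η) C → C.Nontrivial →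
        ∀ P : NearMinCut.PolygonRep C, u₀ ∈ P.outer 0 →
        ∀ T : Finset (Sym2 V), NearMinCut.IsSpanningTree E T →
        ∀ S : Finset V, P.IsRelevant E x η S → Odd (NearMinCut.delta E S ∩ T).card →
          ((¬ P.IsLeftmostCutOrAtom S → ¬ P.IsRightmostCutOrAtom S →
              α * (1 - 7 * η) ≤ ∑ e ∈ NearMinCut.delta E S, s T e) ∧
            (P.LeftHappy E T → P.IsLeftmostCutOrAtom S →
              α * (1 - 7 * η) ≤ ∑ e ∈ NearMinCut.delta E S, s T e) ∧
            (P.RightHappy E T → P.IsRightmostCutOrAtom S →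
              α * (1 - 7 * η) ≤ ∑ e ∈ NearMinCut.delta E S, s T e))) ∧
      (∀ e ∈ E, ∑ T, μ T * s T e ≤ 44 * α * η * x e) := by
  subst hE
  set E := supportEdges x u₀ v₀ with hE
  have hg : IsCutSystem (restrictTo E x) u₀ v₀ := hx.isCutSystem u₀ v₀
  have hdiag : ∀ e ∈ E, ¬ e.IsDiag := by
    intro e he
    simp only [hE, supportEdges, Finset.mem_filter] at he
    exact he.2.1
  have hF : ∀ S ∈ oneSidedCuts E x u₀ v₀ η, u₀ ∉ S := by
    rintro S ⟨D, hD, hSD, -⟩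
    exact (hD.subset hSD).2.1
  refine ⟨raisedVector (oneSidedCuts E x u₀ v₀ η) E x μ α η, raisedVector_nonneg hα hg.nonneg,
    ?_, ?_⟩
  · intro C hC hne P hroot T hT S hS hodd
    have hfam := hC.isOneSidedFamily hne
    have hu : ∀ S ∈ C, u₀ ∉ S := fun S hS => (hfam.avoid S hS).1
    obtain ⟨ι, hι⟩ := P.exists_index (hfam.not_avoidedByCycle hg hη')
    have hH := P.exists_splits hg hfam hroot hι
    have mS := hS.mem_or_isAtom hu hroot
    have hSU := subset_support mS
    have hr := P.outer_zero_eq hu hroot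
    have hU : cutWeight (restrictTo E x) (support C) ≤ 2 + 2 * η := by
      rw [P.support_eq_block hu hroot hι]
      exact (P.isIntervalModel hg hfam hroot hι).cutWeight_univ_le
    have hSne : S.Nonempty := by
      rcases mS with h | h
      · obtain ⟨B, hB, hSB⟩ := hfam.exists_crosses h
        exact hSB.1.mono Finset.inter_subset_left
      · exact h.1.nonempty
    -- S has to be a proper subset of the support, so that there are edges to charge even when no
    -- larger member exists.
    have hSU' : S ≠ support C := by
      rintro rfl
      have hsub : ∀ k, k ≠ 0 → P.outer k ⊆ support C := by
        intro k hk v hv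
        by_contra h
        rw [← Finset.mem_compl, ← hr] at h
        exact hk (P.outer_injective ((P.outer_atom k).eq_of_mem (P.outer_atom 0) hv h))
      have e1 : P.outer 1 ⊆ support C := hsub 1 fun h => by
        have := P.one_val
        rw [h, ZMod.val_zero] at this
        omega
      have e2 : P.outer (-1) ⊆ support C := hsub _ fun h => by
        have h1 := P.neg_one_val
        have h2 := P.three_le
        rw [h, ZMod.val_zero] at h1
        omega
      rcases mS with h | h
      · exact P.not_both_ends hfam hroot hι h e1 e2
      · obtain ⟨v, hv⟩ := (P.outer_atom 1).nonempty
        obtain ⟨w, hw⟩ := (P.outer_atom (-1)).nonempty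
        have a1 := (P.outer_atom 1).eq_of_mem h.1 hv (e1 hv)
        have a2 := (P.outer_atom (-1)).eq_of_mem h.1 hw (e2 hw)
        exact P.one_ne_neg_one (P.outer_injective (a1.trans a2.symm))
    have hnear : cutWeight (restrictTo E x) S ≤ 2 + η := by
      rcases hS with h | ⟨i, -, -, h⟩
      · exact (hfam.near S h).le
      · rwa [← sum_delta]
    obtain ⟨j, hj⟩ := exists_mem_laminarPart mS
    obtain ⟨Y, hY, hch⟩ := exists_charged hη hg hC hfam hH hU hj hSne hSU'
    have hraise : Raises E μ η (C, j, S) T → α * (1 - 7 * η) ≤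
        ∑ e ∈ delta E S, raisedVector (oneSidedCuts E x u₀ v₀ η) E x μ α η T e := fun h =>
      (mul_le_mul_of_nonneg_left (by linarith) hα.le).trans
        (le_sum_raisedVector (i := (C, j, S)) hα hg.nonneg h hY hch)
    by_cases hp : treeProb μ (fun T => Odd (delta E S ∩ T).card) ≤ 11 * η
    · have h := hraise (by rw [Raises, if_pos hp]; exact hodd)
      exact ⟨fun _ _ => h, fun _ _ => h, fun _ _ => h⟩
    -- Oddness of S is not rare here, which rules out two arms and leaves a leftmost or rightmost S.
    rcases hS.arms_or_boundary hg hη hfam hroot hι with harms | ⟨hcompl, hends⟩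
    · exact absurd ((hμ.treeProb_odd_le hdiag hg hnear harms).trans (by linarith)) hp
    have hnU : u₀ ∉ support C ∧ v₀ ∉ support C := by
      constructor <;> intro h <;> obtain ⟨A, hA, h⟩ := mem_support.1 h
      exacts [(hfam.avoid A hA).1 h, (hfam.avoid A hA).2 h]
    have heven := hμ.treeProb_even_le hdiag hg hSU hSne
      (Finset.sdiff_nonempty.2 fun h => hSU' (hSU.antisymm h)) hnU.1 hnU.2 hnear hcompl hU
    have hrS : Disjoint (P.outer 0) S := by
      rw [hr]
      exact Finset.disjoint_left.2 fun v h h' => Finset.mem_compl.1 h (hSU h')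
    have hhappy : ∀ a b : Finset V, a ⊆ S → Disjoint b S →
        Odd (edgesBetween E a (P.outer 0) ∩ T).card →
        (∀ e ∈ T, e ∈ delta E (P.outer 0) →
          e ∈ edgesBetween E a (P.outer 0) ∨ e ∈ edgesBetween E b (P.outer 0)) →
        α * (1 - 7 * η) ≤
          ∑ e ∈ delta E S, raisedVector (oneSidedCuts E x u₀ v₀ η) E x μ α η T e := by
      intro a b ha hb hao h
      -- The tree edges from S to the root are those from `a`, an odd number. As δ(S)_T is odd, the
      -- number of tree edges between S and the rest of the support is even, which is the event of
      -- S.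
      refine hraise ?_
      rw [Raises, if_neg hp]
      refine ⟨heven.trans (by linarith), ?_⟩
      rw [← edgesBetween_inter_eq ha hb hrS h, hr] at hao
      rw [card_delta_inter_eq_add hT.1 hSU] at hodd
      exact (Nat.odd_add'.1 hodd).1 hao
    have hpart : (P.partC E ∩ T).card = 0 → ∀ e ∈ T, e ∈ delta E (P.outer 0) →
        e ∈ P.partA E ∨ e ∈ P.partB E := by
      intro h e heT he
      by_contra! hno
      have : e ∈ P.partC E ∩ T :=
        Finset.mem_inter.2 ⟨Finset.mem_sdiff.2 ⟨Finset.mem_sdiff.2 ⟨he, hno.1⟩, hno.2⟩, heT⟩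
      rw [Finset.card_eq_zero.1 h] at this
      exact absurd this (Finset.notMem_empty e)
    refine ⟨fun h1 h2 => absurd hends (not_or.2 ⟨h1, h2⟩), fun hl hS' => ?_, fun hl hS' => ?_⟩
    · obtain ⟨e1, e2⟩ := hS'.ends hfam hroot hι
      exact hhappy _ _ e1 e2 hl.1 (hpart hl.2)
    · obtain ⟨e1, e2⟩ := hS'.ends hfam hroot hι
      exact hhappy _ _ e1 e2 hl.1 fun e he he' => (hpart hl.2 e he he').symm
  · intro e he
    have h := expect_raisedVector_le (μ := μ) hα hη hg.nonneg hF e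
    rwa [restrictTo, if_pos he] at h
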